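/- **Virial bounds for the Gabitov–Turitsyn equation.** Let $d\ge 1$, let $p\ge 2$ be an even integer with $p\ge \frac8d$, and let $\gamma\in\{-1,1\}$. Consider $$ i u_t+\gamma\Delta u+\int_0^1 e^{-i\sigma\Delta}\Big[\big|e^{i\sigma\Delta}u\big|^p\, e^{i\sigma\Delta}u\Big]\,d\sigma=0,\qquad u(0,\cdot)=u_0\in\mathcal S(\mathbb R^d), \tag{GT}$$ and let $u$ be a Schwartz solution on an open interval $I\ni 0$ (for instance the maximal one): $u\in C(I;\mathcal S(\mathbb R^d))$ and (GT) holds at every point of $I\times\mathbb R^d$. Put $$ v(t)=\int_{\mathbb R^d}|x|^2|u(t,x)|^2\,dx,\qquad \dot v_1(t)=4\,\mathrm{Im}\int_{\mathbb R^d}\overline{u(t,x)}\,\big(x\cdot\nabla u(t,x)\big)\,dx, $$ $$ E(u)=-\frac{\gamma}{2}\int_{\mathbb R^d}|\nabla u|^2\,dx+\frac1{p+2}\int_{\mathbb R^d}\int_0^1\big|e^{i\sigma\Delta}u\big|^{p+2}\,d\sigma\,dx . $$ Then $E(u(t))=E(u_0)$ for all $t\in I$; write $E(u)$ for this value. Moreover: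 1. (Defocusing case, $\gamma=-1$.) There is a constant $C(p,d)>0$, depending only on $p$ and $d$, such that for all $t\in I$ with $-\frac12\le t\le 0$, $$ v(t)\le v(0)-\dot v_1(0)\,t+C(p,d)\,E(u)\,t^2 . $$ 2. (Focusing case, $\gamma=1$.) For all $t\in I$ with $t<0$, $$ v(t)\le v(0)+\dot v_1(0)\,t-8E(u)\,t^2 . $$ 3. In both cases, for all $t\in I$ with $t<0$, $$ \dot v_1(t)\ge \dot v_1(0)-16E(u)\,t . $$ -/

import Mathlib

open scoped SchwartzMap FourierTransform InnerProductSpace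

noncomputable section

namespace GabitovTuritsyn

/-- Euclidean space `ℝ^d`. -/
abbrev Space (d : ℕ) : Type := EuclideanSpace ℝ (Fin d)

/-- The free Schrödinger propagator `e^{iσΔ}`, as the Fourier multiplier with symbol
`e^{-iσ|2πξ|²}` (Mathlib's Fourier transform has the kernel `e^{-2πi⟨x,ξ⟩}`, so that `Δ` has the
symbol `-|2πξ|²`). -/
def freePropagator {d : ℕ} (σ : ℝ) (f : Space d → ℂ) : Space d → ℂ :=
  𝓕⁻ (fun ξ : Space d => Complex.exp (-Complex.I * (σ * (2 * Real.pi * ‖ξ‖) ^ 2 : ℝ)) * 𝓕 f ξ)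

/-- The nonlinearity `∫₀¹ e^{-iσΔ} [ |e^{iσΔ} f|^p · e^{iσΔ} f ] dσ`. -/
def nonlinearity {d : ℕ} (p : ℕ) (f : Space d → ℂ) (x : Space d) : ℂ :=
  ∫ σ in (0 : ℝ)..1,
    freePropagator (-σ)
      (fun y => ((‖freePropagator σ f y‖ ^ p : ℝ) : ℂ) * freePropagator σ f y) x

/-- `u` is a solution, on the open time interval `I ∋ 0`, of the Gabitov–Turitsyn equation
`i u_t + γ Δu + ∫₀¹ e^{-iσΔ} [ |e^{iσΔ} u|^p · e^{iσΔ} u ] dσ = 0` with `u(0) = u₀`: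
a continuous curve in the Schwartz space that satisfies the equation, in the form
`u_t = i (γ Δu + ∫₀¹ …)`, at every point of `I × ℝ^d`. The maximal solution is the special case
in which `I` is the maximal interval of existence. -/
structure IsSolution {d : ℕ} (p : ℕ) (γ : ℝ) (u₀ : 𝓢(Space d, ℂ)) (I : Set ℝ)
    (u : ℝ → 𝓢(Space d, ℂ)) : Prop where
  isOpen : IsOpen I
  ordConnected : I.OrdConnected
  zero_mem : (0 : ℝ) ∈ I
  continuousOn : ContinuousOn u I
  initial : u 0 = u₀
  equation : ∀ t ∈ I, ∀ x : Space d,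
    HasDerivAt (fun s => u s x)
      (Complex.I * ((γ : ℂ) * Laplacian.laplacian (u t : Space d → ℂ) x
        + nonlinearity p (u t : Space d → ℂ) x)) t

/-- `∂_j f`. -/
def partialDeriv {d : ℕ} (j : Fin d) (f : Space d → ℂ) (x : Space d) : ℂ :=
  fderiv ℝ f x (EuclideanSpace.single j 1)

/-- The energy
`E(f) = -(γ/2) ∫ |∇f|² dx + 1/(p+2) ∫ ∫₀¹ |e^{iσΔ} f|^{p+2} dσ dx`. -/
def energy {d : ℕ} (p : ℕ) (γ : ℝ) (f : Space d → ℂ) : ℝ :=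
  -(γ / 2) * (∫ x, ∑ j, ‖partialDeriv j f x‖ ^ 2)
    + 1 / ((p : ℝ) + 2) * ∫ x, ∫ σ in (0 : ℝ)..1, ‖freePropagator σ f x‖ ^ (p + 2)

/-- The variance `∫ |x|² |f(x)|² dx`. -/
def variance {d : ℕ} (f : Space d → ℂ) : ℝ :=
  ∫ x, ‖x‖ ^ 2 * ‖f x‖ ^ 2

/-- `v̇₁ = 4 Im ∫ f̄ (x · ∇f) dx`. -/
def vDotOne {d : ℕ} (f : Space d → ℂ) : ℝ :=
  4 * (∫ x : Space d, (starRingEnd ℂ) (f x) * ∑ j, ((x j : ℝ) : ℂ) * partialDeriv j f x).im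

end GabitovTuritsyn

end

/-!
The curve `t ↦ u t` is differentiable in `L²`, because a continuous curve in the Schwartz space
that solves the equation pointwise also solves it in the weighted sup norm. For an `L²`-symmetric
operator `A`, this gives `d/dt ⟪u, A u⟫ = 2 Re ⟪A u, u'⟫`. The variance is the case `A = |x|²` and
the virial quantity `v̇₁` is the case of the self-adjoint generator of dilations. Their
commutators with `Δ` produce the linear terms `γ v̇₁` and `-16 E`.

In the nonlinear terms the propagator `e^{iσΔ}` is moved onto `A u`. Conjugation by it turns the
dilation generator into itself plus a multiple of `σΔ`, and `|x|²` into a quadratic polynomial in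
`σ`. The local terms `⟪Δ f, |f|^p f⟫` that appear are `σ`-derivatives of `∫ |e^{iσΔ} u|^{p+2}`, so
that integrating by parts in `σ` leaves only the average of this potential, its first moment, and
its value at `σ = 1`. The condition `dp ≥ 8` makes the resulting coefficients nonnegative.
-/

noncomputable section

namespace GabitovTuritsyn

open MeasureTheory SchwartzMap Filter Topology Set
open scoped ContDiff

section Multiplication

variable {E F : Type*} [NormedAddCommGroup E] [NormedSpace ℝ E]
  [NormedAddCommGroup F] [NormedSpace ℝ F]

/-- The largest of the Schwartz seminorms with at most `k` powers of `‖x‖` and at most `n`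
derivatives. -/
def supSeminorm (k n : ℕ) : Seminorm ℝ 𝓢(E, F) :=
  (Finset.Iic (k, n)).sup (schwartzSeminormFamily ℝ E F)

lemma continuous_supSeminorm (k n : ℕ) : Continuous (supSeminorm k n : Seminorm ℝ 𝓢(E, F)) :=
  Seminorm.continuous_finsetSup fun m _ =>
    (schwartz_withSeminorms ℝ E F).continuous_seminorm m

lemma one_add_norm_pow_mul_le_supSeminorm {k n i : ℕ} (hi : i ≤ n) (f : 𝓢(E, F)) (x : E) :
    (1 + ‖x‖) ^ k * ‖iteratedFDeriv ℝ i f x‖ ≤ 2 ^ k * supSeminorm k n f :=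
  one_add_le_sup_seminorm_apply (𝕜 := ℝ) (m := (k, n)) le_rfl hi f x

lemma seminorm_le_of_eq_smul [NormedSpace ℂ F] {k l n : ℕ} {C : ℝ} {g : E → ℂ} (hg : ContDiff ℝ ∞ g)
    (hgC : ∀ i ≤ n, ∀ x, ‖iteratedFDeriv ℝ i g x‖ ≤ C * (1 + ‖x‖) ^ l) {f h : 𝓢(E, F)}
    (hh : ∀ x, h x = g x • f x) :
    SchwartzMap.seminorm ℝ k n h ≤ 2 ^ n * C * (2 ^ (k + l) * supSeminorm (k + l) n f) := by
  have hC : 0 ≤ C := by simpa using (norm_nonneg _).trans (hgC 0 n.zero_le 0)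
  refine seminorm_le_bound ℝ k n h (by positivity) fun x => ?_
  rw [show (h : E → F) = fun y => g y • f y from funext hh]
  calc ‖x‖ ^ k * ‖iteratedFDeriv ℝ n (fun y => g y • f y) x‖
      ≤ (1 + ‖x‖) ^ k * ∑ i ∈ Finset.range (n + 1),
          (n.choose i : ℝ) * ‖iteratedFDeriv ℝ i g x‖ * ‖iteratedFDeriv ℝ (n - i) f x‖ := by
        gcongr
        · linarith
        · exact norm_iteratedFDeriv_smul_le (𝕜 := ℝ) hg (f.smooth ⊤) x (mod_cast le_top)
    _ ≤ ∑ i ∈ Finset.range (n + 1), (n.choose i : ℝ) * (C *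
          ((1 + ‖x‖) ^ (k + l) * ‖iteratedFDeriv ℝ (n - i) f x‖)) := by
        rw [Finset.mul_sum]
        refine Finset.sum_le_sum fun i hi => ?_
        grw [hgC i (Nat.lt_succ_iff.1 (Finset.mem_range.1 hi)) x]
        exact le_of_eq (by ring)
    _ ≤ ∑ i ∈ Finset.range (n + 1),
          (n.choose i : ℝ) * (C * (2 ^ (k + l) * supSeminorm (k + l) n f)) := by
        refine Finset.sum_le_sum fun i _ => ?_
        gcongr ((n.choose i : ℝ) * (C * ?_))
        exact one_add_norm_pow_mul_le_supSeminorm (n.sub_le i) f x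
    _ = _ := by
        rw [← Finset.sum_mul, ← Nat.cast_sum, Nat.sum_range_choose]
        push_cast
        ring

/-- The pointwise product of two Schwartz functions. -/
def schwartzMul (f g : 𝓢(E, ℂ)) : 𝓢(E, ℂ) := pairing (ContinuousLinearMap.mul ℂ ℂ) f g

@[simp] lemma schwartzMul_apply (f g : 𝓢(E, ℂ)) (x : E) : schwartzMul f g x = f x * g x := rfl

lemma seminorm_schwartzMul_le (k n : ℕ) (f g : 𝓢(E, ℂ)) :
    SchwartzMap.seminorm ℝ k n (schwartzMul f g) ≤
      2 ^ n * supSeminorm 0 n f * (2 ^ k * supSeminorm k n g) := by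
  refine seminorm_le_of_eq_smul (l := 0) (f.smooth ⊤) (fun i hi x => ?_) fun x => rfl
  simpa using one_add_norm_pow_mul_le_supSeminorm (k := 0) hi f x

@[fun_prop]
lemma continuous_schwartzMul {X : Type*} [TopologicalSpace X] {u v : X → 𝓢(E, ℂ)}
    (hu : Continuous u) (hv : Continuous v) : Continuous fun x => schwartzMul (u x) (v x) := by
  let B : 𝓢(E, ℂ) →+ 𝓢(E, ℂ) →+ 𝓢(E, ℂ) :=
    AddMonoidHom.mk' (fun f => (pairing (ContinuousLinearMap.mul ℂ ℂ) f).toLinearMap.toAddMonoidHom)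
      fun f g => by ext h; simp
  refine (continuous_of_continuousAt_zero₂ B ?_
    (fun f => (pairing (ContinuousLinearMap.mul ℂ ℂ) f).continuous.continuousAt)
    (fun g => (pairing_continuous_left _ g).continuousAt)).comp₂ hu hv
  refine ((schwartz_withSeminorms ℝ E ℂ).tendsto_nhds _ _).2 fun ⟨k, n⟩ ε hε => ?_
  have hlim : Tendsto (fun z : 𝓢(E, ℂ) × 𝓢(E, ℂ) =>
      2 ^ n * supSeminorm 0 n z.1 * (2 ^ k * supSeminorm k n z.2)) (𝓝 (0, 0)) (𝓝 0) := by
    refine Continuous.tendsto' ?_ _ _ (by simp)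
    have := @continuous_supSeminorm E ℂ
    fun_prop
  filter_upwards [hlim.eventually_lt_const hε] with z hz
  have hB : B (0, 0).1 (0, 0).2 = 0 := map_zero _
  rw [hB, sub_zero]
  exact (seminorm_schwartzMul_le k n z.1 z.2).trans_lt hz

/-- Complex conjugation of Schwartz functions. -/
def schwartzConj : 𝓢(E, ℂ) →L[ℝ] 𝓢(E, ℂ) := postcompCLM (Complex.conjCLE : ℂ →L[ℝ] ℂ)

@[simp] lemma schwartzConj_apply (f : 𝓢(E, ℂ)) (x : E) :
    schwartzConj f x = (starRingEnd ℂ) (f x) := rfl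

/-- The Schwartz function `|f| ^ (2 * q) * f`, built from the smooth factor
`|f| ^ 2 = f * conj f`. -/
def powMul (q : ℕ) (f : 𝓢(E, ℂ)) : 𝓢(E, ℂ) :=
  (schwartzMul (schwartzMul f (schwartzConj f)))^[q] f

lemma powMul_zero (f : 𝓢(E, ℂ)) : powMul 0 f = f := rfl

lemma powMul_succ (q : ℕ) (f : 𝓢(E, ℂ)) :
    powMul (q + 1) f = schwartzMul (schwartzMul f (schwartzConj f)) (powMul q f) :=
  Function.iterate_succ_apply' _ _ _

lemma powMul_apply (q : ℕ) (f : 𝓢(E, ℂ)) (x : E) :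
    powMul q f x = ((‖f x‖ ^ (2 * q) : ℝ) : ℂ) * f x := by
  induction q with
  | zero => simp [powMul_zero]
  | succ q ih =>
    rw [powMul_succ, schwartzMul_apply, ih, schwartzMul_apply, schwartzConj_apply, Complex.mul_conj,
      Complex.normSq_eq_norm_sq]
    push_cast
    ring

lemma continuous_powMul (q : ℕ) : Continuous (powMul q : 𝓢(E, ℂ) → 𝓢(E, ℂ)) := by
  induction q with
  | zero => exact continuous_id
  | succ q ih =>
    simp only [funext (powMul_succ (E := E) q)]
    fun_prop

end Multiplication

section UnimodularMultiplier

variable {E F : Type*} [NormedAddCommGroup E] [NormedSpace ℝ E]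
  [NormedAddCommGroup F] [NormedSpace ℝ F] [NormedSpace ℂ F]

lemma norm_cexp_neg_I_mul (r : ℝ) : ‖Complex.exp (-Complex.I * r)‖ = 1 := by
  rw [neg_mul, ← mul_neg, mul_comm, ← Complex.ofReal_neg, Complex.norm_exp_ofReal_mul_I]

lemma norm_cexp_neg_I_mul_sub_one_le (r : ℝ) : ‖Complex.exp (-Complex.I * r) - 1‖ ≤ |r| := by
  simpa using Real.norm_exp_I_mul_ofReal_sub_one_le (x := -r)

lemma iteratedDeriv_cexp_const_mul_ofReal (c : ℂ) (n : ℕ) :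
    iteratedDeriv n (fun r : ℝ => Complex.exp (c * r)) =
      fun r : ℝ => c ^ n * Complex.exp (c * r) := by
  induction n with
  | zero => simp
  | succ n ih =>
    ext r
    have hexp : HasDerivAt (fun r : ℝ => Complex.exp (c * r)) _ r :=
      ((Complex.ofRealCLM.hasDerivAt (x := r)).const_mul c).cexp
    rw [iteratedDeriv_succ, ih, (hexp.const_mul _).deriv]
    simp only [Complex.ofRealCLM_apply, Complex.ofReal_one, mul_one]
    ring

lemma contDiff_cexp_neg_I_mul (τ : ℝ) :
    ContDiff ℝ ∞ fun r : ℝ => Complex.exp (-Complex.I * (τ * r : ℝ)) :=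
  (contDiff_const.mul (Complex.ofRealCLM.contDiff.comp (contDiff_const.mul contDiff_id))).cexp

lemma norm_iteratedFDeriv_cexp_neg_I_mul_sub_one_le {τ : ℝ} (hτ : |τ| ≤ 1) (n : ℕ) (r : ℝ) :
    ‖iteratedFDeriv ℝ n (fun r : ℝ => Complex.exp (-Complex.I * (τ * r : ℝ)) - 1) r‖ ≤
      |τ| * (1 + |r|) := by
  rw [norm_iteratedFDeriv_eq_norm_iteratedDeriv]
  rcases n.eq_zero_or_pos with rfl | hn
  · rw [iteratedDeriv_zero]
    refine (norm_cexp_neg_I_mul_sub_one_le _).trans ?_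
    rw [abs_mul]
    gcongr
    linarith
  · have hderiv : iteratedDeriv n (fun r : ℝ => Complex.exp (-Complex.I * (τ * r : ℝ)) - 1) r =
        (-Complex.I * τ) ^ n * Complex.exp (-Complex.I * (τ * r : ℝ)) := by
      simp only [sub_eq_neg_add, Complex.ofReal_mul, ← mul_assoc, iteratedDeriv_const_add hn,
        iteratedDeriv_cexp_const_mul_ofReal]
    rw [hderiv, norm_mul, norm_cexp_neg_I_mul]
    simp only [norm_pow, norm_mul, norm_neg, Complex.norm_I, Complex.norm_real, Real.norm_eq_abs,
      one_mul, mul_one]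
    calc |τ| ^ n ≤ |τ| := pow_le_of_le_one (abs_nonneg τ) hτ hn.ne'
      _ ≤ |τ| * (1 + |r|) := le_mul_of_one_le_right (abs_nonneg τ) (by linarith [abs_nonneg r])

lemma exists_norm_iteratedFDeriv_cexp_comp_sub_one_le {φ : E → ℝ} (hφ : φ.HasTemperateGrowth)
    (n : ℕ) :
    ∃ (l : ℕ) (C : ℝ), ∀ τ : ℝ, |τ| ≤ 1 → ∀ i ≤ n, ∀ x,
      ‖iteratedFDeriv ℝ i (fun x => Complex.exp (-Complex.I * (τ * φ x : ℝ)) - 1) x‖ ≤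
        |τ| * C * (1 + ‖x‖) ^ l := by
  obtain ⟨k, C, hC, hbound⟩ := hφ.norm_iteratedFDeriv_le_uniform n
  refine ⟨k * (n + 1), n.factorial * (1 + C) ^ (n + 1), fun τ hτ i hi x => ?_⟩
  set D : ℝ := (1 + C) * (1 + ‖x‖) ^ k
  have hpow : 1 ≤ (1 + ‖x‖) ^ k := one_le_pow₀ (by linarith [norm_nonneg x])
  have hCD : C * (1 + ‖x‖) ^ k + 1 ≤ D := by simp only [D]; linarith
  have hD : 1 ≤ D := (le_add_of_nonneg_left (by positivity)).trans hCD
  have hφx : |φ x| ≤ C * (1 + ‖x‖) ^ k := by simpa using hbound 0 n.zero_le x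
  calc _ ≤ i.factorial * (|τ| * (1 + |φ x|)) * D ^ i :=
        norm_iteratedFDeriv_comp_le (𝕜 := ℝ) ((contDiff_cexp_neg_I_mul τ).sub contDiff_const) hφ.1
          (mod_cast le_top) x
          (fun j _ => norm_iteratedFDeriv_cexp_neg_I_mul_sub_one_le hτ j _)
          fun j hj hji => ((hbound j (hji.trans hi) x).trans (by linarith)).trans
            (le_self_pow₀ hD (by omega))
    _ ≤ n.factorial * (|τ| * D) * D ^ n := by
        gcongr
        linarith
    _ = _ := by
        simp only [D, pow_succ, mul_pow, ← pow_mul]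
        ring

lemma hasTemperateGrowth_cexp_neg_I_mul {φ : E → ℝ} (hφ : φ.HasTemperateGrowth) :
    (fun x => Complex.exp (-Complex.I * (φ x : ℝ))).HasTemperateGrowth := by
  have hsub : (fun x => Complex.exp (-Complex.I * (φ x : ℝ)) - 1).HasTemperateGrowth := by
    refine ⟨?_, fun n => ?_⟩
    · have := ((contDiff_cexp_neg_I_mul 1).comp hφ.1).sub (contDiff_const (c := (1 : ℂ)))
      simpa [Function.comp_def] using this
    · obtain ⟨l, C, h⟩ := exists_norm_iteratedFDeriv_cexp_comp_sub_one_le hφ n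
      exact ⟨l, C, fun x => by simpa using h 1 (by simp) n le_rfl x⟩
  have hadd := hsub.add (.const (1 : ℂ))
  rwa [show (_ : E → ℂ) + _ = _ from funext fun x => sub_add_cancel _ _] at hadd

lemma exists_seminorm_cexp_smul_sub_le {φ : E → ℝ} (hφ : φ.HasTemperateGrowth) (k n : ℕ) :
    ∃ (l : ℕ) (C : ℝ), ∀ τ : ℝ, |τ| ≤ 1 → ∀ f : 𝓢(E, F),
      SchwartzMap.seminorm ℝ k n
        (smulLeftCLM F (fun x => Complex.exp (-Complex.I * (τ * φ x : ℝ))) f - f) ≤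
          |τ| * C * supSeminorm l n f := by
  obtain ⟨l, C, h⟩ := exists_norm_iteratedFDeriv_cexp_comp_sub_one_le hφ n
  refine ⟨k + l, 2 ^ n * C * 2 ^ (k + l), fun τ hτ f => ?_⟩
  have hexp : (fun x => Complex.exp (-Complex.I * (τ * φ x : ℝ))).HasTemperateGrowth :=
    hasTemperateGrowth_cexp_neg_I_mul ((Function.HasTemperateGrowth.const τ).mul hφ)
  refine (seminorm_le_of_eq_smul (hexp.1.sub contDiff_const) (h τ hτ) (f := f) fun x => ?_).trans
    (le_of_eq (by ring))
  rw [sub_apply, smulLeftCLM_apply_apply (by exact hexp), sub_smul, one_smul]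

end UnimodularMultiplier

section Propagator

open LineDeriv Laplacian FourierTransform

variable {E : Type*} [NormedAddCommGroup E]

/-- The symbol `e^{-iσ|2πξ|²}` of `e^{iσΔ}`. -/
def symbol (σ : ℝ) (ξ : E) : ℂ :=
  Complex.exp (-Complex.I * (σ * (2 * Real.pi * ‖ξ‖) ^ 2 : ℝ))

lemma symbol_zero : (symbol 0 : E → ℂ) = 1 := by
  ext ξ
  simp [symbol]

lemma symbol_add (σ τ : ℝ) : (symbol (σ + τ) : E → ℂ) = symbol σ * symbol τ := by
  ext ξ
  simp only [symbol, Pi.mul_apply, ← Complex.exp_add, add_mul, Complex.ofReal_add, mul_add]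

lemma norm_symbol (σ : ℝ) (ξ : E) : ‖symbol σ ξ‖ = 1 := norm_cexp_neg_I_mul _

lemma hasDerivAt_symbol (σ : ℝ) (ξ : E) :
    HasDerivAt (fun σ => symbol σ ξ)
      (-Complex.I * ((2 * Real.pi * ‖ξ‖) ^ 2 : ℝ) * symbol σ ξ) σ := by
  have hlin : HasDerivAt (fun σ : ℝ => -Complex.I * (σ * (2 * Real.pi * ‖ξ‖) ^ 2 : ℝ))
      (-Complex.I * ((2 * Real.pi * ‖ξ‖) ^ 2 : ℝ)) σ := by
    convert! ((hasDerivAt_id σ).mul_const ((2 * Real.pi * ‖ξ‖) ^ 2)).ofReal_comp.const_mul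
      (-Complex.I) using 1
    rw [one_mul]
  exact hlin.cexp.congr_deriv (mul_comm _ _)

variable [InnerProductSpace ℝ E]

lemma hasTemperateGrowth_phase : (fun ξ : E => (2 * Real.pi * ‖ξ‖) ^ 2).HasTemperateGrowth := by
  simp only [mul_pow _ ‖_‖]
  fun_prop

@[fun_prop]
lemma hasTemperateGrowth_symbol (σ : ℝ) : (symbol σ : E → ℂ).HasTemperateGrowth :=
  hasTemperateGrowth_cexp_neg_I_mul
    ((Function.HasTemperateGrowth.const σ).mul hasTemperateGrowth_phase)

lemma hasFDerivAt_symbol (σ : ℝ) (ξ : E) :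
    HasFDerivAt (symbol σ)
      ((-(8 * Real.pi ^ 2 * Complex.I * σ) * symbol σ ξ) •
        (Complex.ofRealCLM.comp (innerSL ℝ ξ))) ξ := by
  have hphase : HasFDerivAt (fun ξ : E => σ * (2 * Real.pi * ‖ξ‖) ^ 2)
      ((σ * (2 * Real.pi) ^ 2) • (2 • innerSL ℝ ξ)) ξ := by
    convert! (hasStrictFDerivAt_norm_sq ξ).hasFDerivAt.const_mul (σ * (2 * Real.pi) ^ 2) using 1
    ext
    ring
  convert! ((Complex.ofRealCLM.hasFDerivAt.comp ξ hphase).const_mul (-Complex.I)).cexp using 1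
  ext v
  simp only [symbol, Complex.ofRealCLM_apply, smul_apply, ContinuousLinearMap.comp_apply,
    ContinuousLinearMap.comp_smul, coe_innerSL_apply, Complex.ofReal_mul, Complex.ofReal_pow,
    Complex.ofReal_ofNat, Complex.real_smul, nsmul_eq_mul, Nat.cast_ofNat, smul_eq_mul,
    Function.comp_apply]
  ring

/-- Multiplication by the coordinate `⟪x, e⟫` of `x` in the direction `e`. -/
def position (e : E) : 𝓢(E, ℂ) →L[ℂ] 𝓢(E, ℂ) :=
  smulLeftCLM ℂ fun x => ((inner ℝ x e : ℝ) : ℂ)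

@[simp] lemma position_apply (e : E) (f : 𝓢(E, ℂ)) (x : E) :
    position e f x = ((inner ℝ x e : ℝ) : ℂ) * f x := by
  rw [position, smulLeftCLM_apply_apply (by fun_prop), smul_eq_mul]

lemma smulLeftCLM_inner (e : E) (f : 𝓢(E, ℂ)) :
    smulLeftCLM ℂ (fun x => inner ℝ x e) f = position e f := by
  ext x
  rw [smulLeftCLM_apply_apply (by fun_prop), position_apply, Complex.real_smul]

lemma lineDerivOp_smulLeftCLM_symbol (σ : ℝ) (e : E) (f : 𝓢(E, ℂ)) :
    ∂_{e} (smulLeftCLM ℂ (symbol σ) f) = smulLeftCLM ℂ (symbol σ) (∂_{e} f) +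
      (-(8 * Real.pi ^ 2 * Complex.I * σ) : ℂ) • position e (smulLeftCLM ℂ (symbol σ) f) := by
  ext x
  have hprod := ((hasFDerivAt_symbol σ x).mul (f.hasFDerivAt x)).congr_of_eventuallyEq
    (.of_forall (smulLeftCLM_apply_apply (hasTemperateGrowth_symbol σ) f))
  rw [lineDerivOp_apply_eq_fderiv, hprod.fderiv]
  simp only [_root_.add_apply, _root_.smul_apply, ContinuousLinearMap.comp_apply,
    coe_innerSL_apply, Complex.ofRealCLM_apply, add_apply, smul_apply, position_apply,
    smulLeftCLM_apply_apply (hasTemperateGrowth_symbol σ), lineDerivOp_apply_eq_fderiv,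
    smul_eq_mul]
  rw [real_inner_comm]
  ring

lemma tendsto_smulLeftCLM_symbol (f₀ : 𝓢(E, ℂ)) :
    Tendsto (fun p : ℝ × 𝓢(E, ℂ) => smulLeftCLM ℂ (symbol p.1) p.2) (𝓝 (0, f₀)) (𝓝 f₀) := by
  suffices hdiff : Tendsto (fun p : ℝ × 𝓢(E, ℂ) => smulLeftCLM ℂ (symbol p.1) p.2 - p.2)
      (𝓝 (0, f₀)) (𝓝 0) by
    simpa using hdiff.add continuousAt_snd.tendsto
  rw [(schwartz_withSeminorms ℝ E ℂ).tendsto_nhds]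
  rintro ⟨k, n⟩ ε hε
  obtain ⟨l, C, hC⟩ :=
    exists_seminorm_cexp_smul_sub_le (F := ℂ) (hasTemperateGrowth_phase (E := E)) k n
  have hbound : Tendsto (fun p : ℝ × 𝓢(E, ℂ) => |p.1| * C * supSeminorm l n p.2)
      (𝓝 (0, f₀)) (𝓝 0) := by
    have hcont : Continuous fun p : ℝ × 𝓢(E, ℂ) => |p.1| * C * supSeminorm l n p.2 :=
      (continuous_fst.abs.mul_const C).mul ((continuous_supSeminorm l n).comp continuous_snd)
    simpa using hcont.tendsto (0, f₀)
  have hsmall : ∀ᶠ p : ℝ × 𝓢(E, ℂ) in 𝓝 (0, f₀), |p.1| ≤ 1 :=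
    (continuous_fst.abs.tendsto (0, f₀)).eventually_le_const (by simp)
  filter_upwards [hsmall, hbound.eventually_lt_const hε] with p hp hpε
  rw [sub_zero]
  exact (hC p.1 hp p.2).trans_lt hpε

variable [FiniteDimensional ℝ E] [MeasurableSpace E] [BorelSpace E]

/-- The free propagator `e^{iσΔ}` on Schwartz functions. -/
def propagator (σ : ℝ) : 𝓢(E, ℂ) →L[ℂ] 𝓢(E, ℂ) := fourierMultiplierCLM ℂ (symbol σ)

lemma propagator_apply (σ : ℝ) (f : 𝓢(E, ℂ)) :
    propagator σ f = 𝓕⁻ (smulLeftCLM ℂ (symbol σ) (𝓕 f)) :=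
  fourierMultiplierCLM_apply _ _

lemma fourier_propagator (σ : ℝ) (f : 𝓢(E, ℂ)) :
    𝓕 (propagator σ f) = smulLeftCLM ℂ (symbol σ) (𝓕 f) := by
  rw [propagator_apply, FourierTransform.fourier_fourierInv_eq]

@[simp] lemma propagator_zero (f : 𝓢(E, ℂ)) : propagator 0 f = f := by
  have hsymbol : smulLeftCLM ℂ (symbol 0) (𝓕 f) = 𝓕 f := by
    ext ξ
    rw [smulLeftCLM_apply_apply (by fun_prop), symbol_zero, Pi.one_apply, one_smul]
  rw [propagator_apply, hsymbol, FourierTransform.fourierInv_fourier_eq]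

lemma propagator_add (σ τ : ℝ) (f : 𝓢(E, ℂ)) :
    propagator (σ + τ) f = propagator σ (propagator τ f) := by
  rw [propagator, symbol_add, propagator, propagator,
    fourierMultiplierCLM_fourierMultiplierCLM_apply (by fun_prop) (by fun_prop)]

@[simp] lemma propagator_propagator_neg (σ : ℝ) (f : 𝓢(E, ℂ)) :
    propagator σ (propagator (-σ) f) = f := by
  rw [← propagator_add, add_neg_cancel, propagator_zero]

lemma propagator_lineDerivOp (σ : ℝ) (e : E) (f : 𝓢(E, ℂ)) :
    propagator σ (∂_{e} f) = ∂_{e} (propagator σ f) := by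
  rw [propagator_apply, propagator_apply, fourier_lineDerivOp_eq, lineDerivOp_fourierInv_eq,
    map_smul, smulLeftCLM_inner, smulLeftCLM_inner]
  congr 2
  ext x
  simp only [smulLeftCLM_apply_apply (hasTemperateGrowth_symbol σ), position_apply, smul_eq_mul]
  ring

lemma propagator_laplacian (σ : ℝ) (f : 𝓢(E, ℂ)) :
    propagator σ (Δ f) = Δ (propagator σ f) := by
  simp only [laplacian_eq_sum (stdOrthonormalBasis ℝ E), map_sum, propagator_lineDerivOp]

lemma propagator_position (σ : ℝ) (e : E) (f : 𝓢(E, ℂ)) :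
    propagator σ (position e f) =
      position e (propagator σ f) + (2 * Complex.I * σ) • ∂_{e} (propagator σ f) := by
  have hI : (2 * Real.pi * Complex.I : ℂ) ≠ 0 := by simp [Real.pi_ne_zero]
  have hsymbol := congrArg (fun g : 𝓢(E, ℂ) => 𝓕⁻ g) (lineDerivOp_smulLeftCLM_symbol σ e (𝓕 f))
  have hderiv : ∂_{e} (propagator σ f) =
      (2 * Real.pi * Complex.I) • 𝓕⁻ (position e (smulLeftCLM ℂ (symbol σ) (𝓕 f))) := by
    rw [propagator_apply, lineDerivOp_fourierInv_eq, smulLeftCLM_inner, fourierInv_smul]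
  simp only [fourierInv_lineDerivOp_eq, lineDerivOp_fourier_eq, smulLeftCLM_inner, fourierInv_add,
    fourierInv_smul, fourier_smul, map_smul, ← propagator_apply] at hsymbol
  have hcoeff : (-(8 * Real.pi ^ 2 * Complex.I * σ) : ℂ) =
      2 * Real.pi * Complex.I * (2 * Complex.I * σ) * (2 * Real.pi * Complex.I) := by
    linear_combination (-(8 * Real.pi ^ 2 * Complex.I * σ) : ℂ) * Complex.I_sq
  rw [hcoeff] at hsymbol
  refine smul_right_injective _ hI ?_
  simp only [hderiv]
  linear_combination (norm := module) hsymbol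

@[fun_prop]
lemma continuous_propagator {X : Type*} [TopologicalSpace X] {σ : X → ℝ} {f : X → 𝓢(E, ℂ)}
    (hσ : Continuous σ) (hf : Continuous f) : Continuous fun x => propagator (σ x) (f x) := by
  rw [continuous_iff_continuousAt]
  intro x₀
  have hshift : Tendsto (fun x => (σ x - σ x₀, 𝓕 (f x))) (𝓝 x₀) (𝓝 (0, 𝓕 (f x₀))) := by
    have hcont : Continuous fun x => (σ x - σ x₀, fourierCLM ℂ 𝓢(E, ℂ) (f x)) := by fun_prop
    simpa using hcont.tendsto x₀
  have hprop : ∀ x, propagator (σ x) (f x) = propagator (σ x₀)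
      (fourierInvCLM ℂ 𝓢(E, ℂ) (smulLeftCLM ℂ (symbol (σ x - σ x₀)) (𝓕 (f x)))) := fun x => by
    rw [fourierInvCLM_apply, ← propagator_apply, ← propagator_add, add_sub_cancel]
  have hlim := (tendsto_smulLeftCLM_symbol _).comp hshift
  have hcont : Continuous fun g : 𝓢(E, ℂ) => propagator (σ x₀) (fourierInvCLM ℂ 𝓢(E, ℂ) g) := by
    fun_prop
  have hcomp := (hcont.tendsto _).comp hlim
  rw [fourierInvCLM_apply, fourierInv_fourier_eq] at hcomp
  exact hcomp.congr fun x => (hprop x).symm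

end Propagator

section Operators

open LineDeriv Laplacian FourierTransform Module

variable {E : Type*} [NormedAddCommGroup E] [InnerProductSpace ℝ E]

lemma lineDerivOp_position (e e' : E) (f : 𝓢(E, ℂ)) :
    ∂_{e} (position e' f) = position e' (∂_{e} f) + ((inner ℝ e e' : ℝ) : ℂ) • f := by
  ext x
  have hcoord : HasFDerivAt (fun y => ((inner ℝ y e' : ℝ) : ℂ))
      (Complex.ofRealCLM.comp ((innerSL ℝ).flip e')) x :=
    Complex.ofRealCLM.hasFDerivAt.comp x ((innerSL ℝ).flip e').hasFDerivAt
  have hprod := (hcoord.mul (f.hasFDerivAt x)).congr_of_eventuallyEq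
    (.of_forall (position_apply e' f))
  rw [lineDerivOp_apply_eq_fderiv, hprod.fderiv]
  simp only [_root_.add_apply, _root_.smul_apply, ContinuousLinearMap.comp_apply,
    ContinuousLinearMap.flip_apply, innerSL_apply_apply, Complex.ofRealCLM_apply, add_apply,
    smul_apply, position_apply, lineDerivOp_apply_eq_fderiv, smul_eq_mul, mul_comm (f x)]

lemma lineDerivOp_comm (e e' : E) (f : 𝓢(E, ℂ)) : ∂_{e} (∂_{e'} f) = ∂_{e'} (∂_{e} f) := by
  have hsnd (v w : E) (x : E) : ∂_{v} (∂_{w} f) x = fderiv ℝ (fderiv ℝ f) x v w := by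
    have hf' : DifferentiableAt ℝ (fderiv ℝ f) x :=
      ((f.smooth 2).fderiv_right (m := 1) (by norm_num)).differentiable (by simp) x
    have hcoe : ((∂_{w} f : 𝓢(E, ℂ)) : E → ℂ) = fun y => fderiv ℝ f y w :=
      funext fun y => lineDerivOp_apply_eq_fderiv w f y
    rw [lineDerivOp_apply_eq_fderiv, hcoe, fderiv_clm_apply hf' (differentiableAt_const w)]
    simp
  ext x
  rw [hsnd, hsnd]
  exact (f.smooth 2).contDiffAt.isSymmSndFDerivAt (by simp) e e'

/-- Multiplication by `|x|²`. -/
def normSqMul : 𝓢(E, ℂ) →L[ℂ] 𝓢(E, ℂ) := smulLeftCLM ℂ fun x => ((‖x‖ ^ 2 : ℝ) : ℂ)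

lemma normSqMul_apply (f : 𝓢(E, ℂ)) (x : E) : normSqMul f x = ((‖x‖ ^ 2 : ℝ) : ℂ) * f x := by
  rw [normSqMul, smulLeftCLM_apply_apply (by fun_prop), smul_eq_mul]

lemma normSqMul_eq_sum {ι : Type*} [Fintype ι] (b : OrthonormalBasis ι ℝ E) (f : 𝓢(E, ℂ)) :
    normSqMul f = ∑ i, position (b i) (position (b i) f) := by
  ext x
  rw [normSqMul_apply, ← b.sum_sq_inner_left x]
  simp [sum_apply, Finset.sum_mul, sq, mul_assoc]

lemma lineDerivOp_normSqMul (e : E) (f : 𝓢(E, ℂ)) :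
    ∂_{e} (normSqMul f) = normSqMul (∂_{e} f) + (2 : ℂ) • position e f := by
  ext x
  have hprod := ((Complex.ofRealCLM.hasFDerivAt.comp x
    (hasStrictFDerivAt_norm_sq x).hasFDerivAt).mul (f.hasFDerivAt x)).congr_of_eventuallyEq
    (.of_forall (normSqMul_apply f))
  rw [lineDerivOp_apply_eq_fderiv, hprod.fderiv]
  simp only [Function.comp_apply, Complex.ofRealCLM_apply, Complex.ofReal_pow, _root_.add_apply,
    _root_.smul_apply, add_apply, smul_apply, smul_eq_mul, ContinuousLinearMap.comp_apply,
    ContinuousLinearMap.comp_smul, coe_innerSL_apply, nsmul_eq_mul, Nat.cast_ofNat,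
    normSqMul_apply, lineDerivOp_apply_eq_fderiv, position_apply, real_inner_comm]
  ring

variable [FiniteDimensional ℝ E]

/-- The Euler operator `x · ∇`. -/
def euler : 𝓢(E, ℂ) →L[ℂ] 𝓢(E, ℂ) :=
  ∑ i, position (stdOrthonormalBasis ℝ E i) ∘L
    lineDerivOpCLM ℂ 𝓢(E, ℂ) (stdOrthonormalBasis ℝ E i)

lemma euler_eq_sum (f : 𝓢(E, ℂ)) :
    euler f = ∑ i, position (stdOrthonormalBasis ℝ E i) (∂_{stdOrthonormalBasis ℝ E i} f) := by
  simp [euler]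

lemma euler_apply (f : 𝓢(E, ℂ)) (x : E) : euler f x = fderiv ℝ f x x := by
  have hx := congrArg (fderiv ℝ f x) ((stdOrthonormalBasis ℝ E).sum_repr' x)
  rw [map_sum] at hx
  simpa [euler_eq_sum, sum_apply, lineDerivOp_apply_eq_fderiv, real_inner_comm] using hx

/-- The self-adjoint generator `-i (x · ∇ + n / 2)` of the `L²`-dilations. -/
def dilation : 𝓢(E, ℂ) →L[ℂ] 𝓢(E, ℂ) :=
  (-Complex.I) • (euler + ((finrank ℝ E : ℂ) / 2) • ContinuousLinearMap.id ℂ _)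

lemma dilation_apply (f : 𝓢(E, ℂ)) :
    dilation f = (-Complex.I) • (euler f + ((finrank ℝ E : ℂ) / 2) • f) := by
  simp [dilation]

lemma lineDerivOp_euler (e : E) (f : 𝓢(E, ℂ)) : ∂_{e} (euler f) = euler (∂_{e} f) + ∂_{e} f := by
  have he : ∑ i, ((inner ℝ e (stdOrthonormalBasis ℝ E i) : ℝ) : ℂ) •
      ∂_{stdOrthonormalBasis ℝ E i} f = ∂_{e} f := by
    ext x
    have he := congrArg (fderiv ℝ f x) ((stdOrthonormalBasis ℝ E).sum_repr' e)
    rw [map_sum] at he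
    simpa [sum_apply, lineDerivOp_apply_eq_fderiv, real_inner_comm] using he
  simp only [euler_eq_sum, lineDerivOp_sum, lineDerivOp_position, Finset.sum_add_distrib, he,
    lineDerivOp_comm e]

lemma laplacian_euler (f : 𝓢(E, ℂ)) : Δ (euler f) = euler (Δ f) + (2 : ℂ) • Δ f := by
  simp only [laplacian_eq_sum (stdOrthonormalBasis ℝ E), lineDerivOp_euler, lineDerivOp_add,
    Finset.sum_add_distrib, map_sum]
  module

lemma laplacian_dilation (f : 𝓢(E, ℂ)) :
    Δ (dilation f) = dilation (Δ f) - (2 * Complex.I) • Δ f := by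
  have hlin : Δ (dilation f) =
      (-Complex.I) • (Δ (euler f) + ((finrank ℝ E : ℂ) / 2) • Δ f) := by
    simp only [dilation_apply, ← laplacianCLM_eq ℂ, map_smul, map_add]
  rw [hlin, laplacian_euler, dilation_apply]
  module

lemma laplacian_normSqMul (f : 𝓢(E, ℂ)) :
    Δ (normSqMul f) = normSqMul (Δ f) + (4 * Complex.I) • dilation f := by
  simp only [laplacian_eq_sum (stdOrthonormalBasis ℝ E), lineDerivOp_normSqMul, lineDerivOp_add,
    lineDerivOp_smul, lineDerivOp_position, real_inner_self_eq_norm_sq,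
    (stdOrthonormalBasis ℝ E).orthonormal.1, Finset.sum_add_distrib, ← Finset.smul_sum, map_sum,
    dilation_apply, euler_eq_sum, Finset.sum_const, Finset.card_univ, Fintype.card_fin,
    ← Nat.cast_smul_eq_nsmul ℂ]
  linear_combination (norm := (push_cast; module)) (4 * Complex.I_sq) •
    ((∑ i, position (stdOrthonormalBasis ℝ E i) (∂_{stdOrthonormalBasis ℝ E i} f)) +
      ((finrank ℝ E : ℂ) / 2) • f)

variable [MeasurableSpace E] [BorelSpace E]

lemma propagator_normSqMul (σ : ℝ) (f : 𝓢(E, ℂ)) :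
    propagator σ (normSqMul f) = normSqMul (propagator σ f) -
      (4 * σ : ℂ) • dilation (propagator σ f) - (4 * σ ^ 2 : ℂ) • Δ (propagator σ f) := by
  set b := stdOrthonormalBasis ℝ E
  set g := propagator σ f
  have hcoord (i) : propagator σ (position (b i) (position (b i) f)) =
      position (b i) (position (b i) g) + (4 * Complex.I * σ) • position (b i) (∂_{b i} g) +
        (2 * Complex.I * σ) • g - (4 * σ ^ 2 : ℂ) • ∂_{b i} (∂_{b i} g) := by
    simp only [propagator_position, map_add, map_smul, lineDerivOp_add, lineDerivOp_smul,
      lineDerivOp_position, real_inner_self_eq_norm_sq, b.orthonormal.1 i]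
    linear_combination (norm := (push_cast; module))
      (4 * σ ^ 2 * Complex.I_sq) • ∂_{b i} (∂_{b i} g)
  simp only [normSqMul_eq_sum b, map_sum, hcoord, dilation_apply, euler_eq_sum,
    laplacian_eq_sum b, Finset.sum_sub_distrib, Finset.sum_add_distrib, ← Finset.smul_sum,
    Finset.sum_const, Finset.card_univ, Fintype.card_fin, ← Nat.cast_smul_eq_nsmul ℂ]
  module

lemma propagator_dilation (σ : ℝ) (f : 𝓢(E, ℂ)) :
    propagator σ (dilation f) =
      dilation (propagator σ f) + (2 * σ : ℂ) • Δ (propagator σ f) := by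
  have heuler : propagator σ (euler f) =
      euler (propagator σ f) + (2 * Complex.I * σ) • Δ (propagator σ f) := by
    simp only [euler_eq_sum, map_sum, propagator_position, propagator_lineDerivOp,
      Finset.sum_add_distrib, laplacian_eq_sum (stdOrthonormalBasis ℝ E), Finset.smul_sum]
  rw [dilation_apply, dilation_apply, map_smul, map_add, map_smul, heuler]
  linear_combination (norm := module) (-2 * σ * Complex.I_sq) • Δ (propagator σ f)

end Operators

section Weighted

open Module
open scoped BoundedContinuousFunction ENNReal

lemma hasDerivAt_boundedContinuousFunction {α F : Type*} [TopologicalSpace α]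
    [NormedAddCommGroup F] [NormedSpace ℝ F] {u v : ℝ → α →ᵇ F} {t : ℝ}
    (hu : ∀ᶠ s in 𝓝 t, ∀ x, HasDerivAt (fun r => u r x) (v s x) s) (hv : ContinuousAt v t) :
    HasDerivAt u (v t) t := by
  rw [hasDerivAt_iff_isLittleO, Asymptotics.isLittleO_iff]
  intro ε hε
  obtain ⟨δ, hδ, hball⟩ := Metric.eventually_nhds_iff_ball.1
    (hu.and (hv.eventually (Metric.closedBall_mem_nhds _ hε)))
  filter_upwards [Metric.ball_mem_nhds t hδ] with s hs
  refine (BoundedContinuousFunction.norm_le (by positivity)).2 fun x => ?_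
  have hderiv (r : ℝ) (hr : r ∈ Metric.ball t δ) : HasDerivWithinAt
      (fun r => u r x - (r - t) • v t x) (v r x - (1 : ℝ) • v t x) (Metric.ball t δ) r :=
    (((hball r hr).1 x).sub (((hasDerivAt_id r).sub_const t).smul_const _)).hasDerivWithinAt
  have hbound (r : ℝ) (hr : r ∈ Metric.ball t δ) : ‖v r x - (1 : ℝ) • v t x‖ ≤ ε := by
    rw [one_smul, ← dist_eq_norm]
    exact (BoundedContinuousFunction.dist_coe_le_dist x).trans (hball r hr).2
  simpa [sub_right_comm] using (convex_ball t δ).norm_image_sub_le_of_norm_hasDerivWithin_le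
    hderiv hbound (Metric.mem_ball_self hδ) hs

variable {E : Type*} [NormedAddCommGroup E] [InnerProductSpace ℝ E]

/-- A polynomial weight whose inverse lies in every `L^p`. -/
def weight (x : E) : ℝ := (1 + ‖x‖ ^ 2) ^ (finrank ℝ E + 1)

lemma one_le_weight (x : E) : 1 ≤ weight x :=
  one_le_pow₀ (le_add_of_nonneg_right (sq_nonneg _))

lemma hasTemperateGrowth_weight : (fun x : E => (weight x : ℂ)).HasTemperateGrowth := by
  unfold weight
  fun_prop

/-- Multiplication by the weight, as a map from Schwartz functions to bounded continuous
functions. Together with `unweight` it factors the inclusion into `L^p` through a Banach space on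
which point evaluations are continuous. -/
def weighted : 𝓢(E, ℂ) →L[ℂ] E →ᵇ ℂ :=
  toBoundedContinuousFunctionCLM ℂ E ℂ ∘L smulLeftCLM ℂ fun x : E => (weight x : ℂ)

lemma weighted_apply (f : 𝓢(E, ℂ)) (x : E) : weighted f x = weight x * f x := by
  simp [weighted, smulLeftCLM_apply_apply hasTemperateGrowth_weight]

lemma continuous_inv_weight : Continuous fun x : E => (weight x)⁻¹ :=
  (by unfold weight; fun_prop : Continuous (weight : E → ℝ)).inv₀ fun x =>
    (zero_lt_one.trans_le (one_le_weight x)).ne'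

lemma norm_inv_weight_mul_le (g : E →ᵇ ℂ) (x : E) :
    ‖(weight x : ℂ)⁻¹ * g x‖ ≤ ‖g‖ * ‖(weight x)⁻¹‖ := by
  rw [norm_mul, mul_comm, norm_inv, norm_inv, Complex.norm_real]
  gcongr
  exact g.norm_coe_le_norm x

lemma inv_weight_mul_weighted (f : 𝓢(E, ℂ)) (x : E) :
    (weight x : ℂ)⁻¹ * weighted f x = f x := by
  rw [weighted_apply, inv_mul_cancel_left₀]
  exact_mod_cast (zero_lt_one.trans_le (one_le_weight x)).ne'

/-- The curve `h`, averaged over `[0, 1]` after multiplication by the weight. -/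
def weightedAverage (h : ℝ → 𝓢(E, ℂ)) : E →ᵇ ℂ := ∫ σ in (0 : ℝ)..1, weighted (h σ)

lemma inv_weight_mul_weightedAverage {h : ℝ → 𝓢(E, ℂ)} (hh : Continuous h) (x : E) :
    (weight x : ℂ)⁻¹ * weightedAverage h x = ∫ σ in (0 : ℝ)..1, h σ x := by
  have heval := (BoundedContinuousFunction.evalCLM ℂ x).intervalIntegral_comp_comm
    ((weighted.continuous.comp hh).intervalIntegrable (μ := volume) 0 1)
  simp only [BoundedContinuousFunction.evalCLM_apply, Function.comp_apply] at heval
  rw [weightedAverage, ← heval, ← intervalIntegral.integral_const_mul]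
  simp only [inv_weight_mul_weighted]

lemma continuous_weightedAverage {X : Type*} [TopologicalSpace X] {h : X → ℝ → 𝓢(E, ℂ)}
    (hh : Continuous h.uncurry) : Continuous fun x => weightedAverage (h x) :=
  intervalIntegral.continuous_parametric_intervalIntegral_of_continuous'
    (f := fun x σ => weighted (h x σ)) (weighted.continuous.comp hh) 0 1

variable [FiniteDimensional ℝ E] [MeasurableSpace E] [BorelSpace E]

lemma integrable_inv_weight : Integrable (fun x : E => (weight x)⁻¹) volume := by
  have h := integrable_rpow_neg_one_add_norm_sq (E := E) (μ := volume)
    (r := 2 * (finrank ℝ E + 1 : ℕ)) (by push_cast; linarith)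
  refine h.congr (.of_forall fun x => ?_)
  simp only [weight]
  rw [neg_div, Real.rpow_neg (by positivity), mul_div_cancel_left₀ _ two_ne_zero,
    Real.rpow_natCast]

lemma memLp_inv_weight (p : ℝ≥0∞) [hp : Fact (1 ≤ p)] :
    MemLp (fun x : E => (weight x)⁻¹) p volume := by
  have hone (x : E) : ‖(weight x)⁻¹‖ ≤ 1 := by
    rw [norm_inv, inv_le_one₀ (by simpa using (zero_lt_one.trans_le (one_le_weight x)).ne')]
    exact (one_le_weight x).trans (le_abs_self _)
  rcases eq_or_ne p ⊤ with rfl | htop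
  · exact memLp_top_of_bound continuous_inv_weight.aestronglyMeasurable 1 (.of_forall hone)
  have hrpow : Continuous fun x : E => ‖(weight x)⁻¹‖ ^ p.toReal :=
    continuous_inv_weight.norm.rpow_const fun _ => .inr ENNReal.toReal_nonneg
  refine (integrable_norm_rpow_iff continuous_inv_weight.aestronglyMeasurable
    (zero_lt_one.trans_le hp.out).ne' htop).1
      (integrable_inv_weight.norm.mono' hrpow.aestronglyMeasurable (.of_forall fun x => ?_))
  rw [Real.norm_of_nonneg (by positivity)]
  exact Real.rpow_le_self_of_le_one (norm_nonneg _) (hone x)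
    ((ENNReal.toReal_mono htop hp.out).trans' (by simp))

lemma memLp_inv_weight_mul (p : ℝ≥0∞) [Fact (1 ≤ p)] (g : E →ᵇ ℂ) :
    MemLp (fun x => (weight x : ℂ)⁻¹ * g x) p volume :=
  (memLp_inv_weight p).of_le_mul (Continuous.aestronglyMeasurable <| by
    have := Complex.continuous_ofReal.comp (continuous_inv_weight (E := E))
    simp only [Function.comp_def, Complex.ofReal_inv] at this
    exact this.mul g.continuous)
    (.of_forall (norm_inv_weight_mul_le g))

/-- Division by the weight, as a map from bounded continuous functions to `L^p`. -/
def unweight (p : ℝ≥0∞) [Fact (1 ≤ p)] : (E →ᵇ ℂ) →L[ℂ] Lp ℂ p (volume : Measure E) :=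
  LinearMap.mkContinuous
    { toFun g := (memLp_inv_weight_mul p g).toLp _
      map_add' g h := by
        rw [← MemLp.toLp_add]
        exact MemLp.toLp_congr _ _ (.of_forall fun x => mul_add _ _ _)
      map_smul' c g := by
        rw [RingHom.id_apply, ← MemLp.toLp_const_smul]
        exact MemLp.toLp_congr _ _ (.of_forall fun x => mul_left_comm _ _ _) }
    ‖(memLp_inv_weight p).toLp _‖ fun g => by
      rw [mul_comm]
      refine Lp.norm_le_mul_norm_of_ae_le_mul ?_
      filter_upwards [(memLp_inv_weight_mul p g).coeFn_toLp,
        (memLp_inv_weight (E := E) p).coeFn_toLp] with x hx hx'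
      simpa only [LinearMap.coe_mk, AddHom.coe_mk, hx, hx'] using norm_inv_weight_mul_le g x

lemma coeFn_unweight (p : ℝ≥0∞) [Fact (1 ≤ p)] (g : E →ᵇ ℂ) :
    unweight p g =ᵐ[volume] fun x => (weight x : ℂ)⁻¹ * g x :=
  (memLp_inv_weight_mul p g).coeFn_toLp

lemma unweight_weighted (p : ℝ≥0∞) [Fact (1 ≤ p)] (f : 𝓢(E, ℂ)) :
    unweight p (weighted f) = f.toLp p := by
  refine Lp.ext ((coeFn_unweight p _).trans ?_)
  simp only [inv_weight_mul_weighted]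
  exact (f.coeFn_toLp p).symm

lemma hasDerivAt_toLp (p : ℝ≥0∞) [Fact (1 ≤ p)] {u : ℝ → 𝓢(E, ℂ)} {v : ℝ → E →ᵇ ℂ} {t : ℝ}
    (hu : ∀ᶠ s in 𝓝 t, ∀ x, HasDerivAt (fun r => u r x) ((weight x : ℂ)⁻¹ * v s x) s)
    (hv : ContinuousAt v t) :
    HasDerivAt (fun s => (u s).toLp p) (unweight p (v t)) t := by
  simp only [← unweight_weighted]
  refine ((unweight (E := E) p).restrictScalars ℝ).hasFDerivAt.comp_hasDerivAt t
    (hasDerivAt_boundedContinuousFunction ?_ hv)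
  filter_upwards [hu] with s hs x
  have hweight : (weight x : ℂ) ≠ 0 := by
    exact_mod_cast (zero_lt_one.trans_le (one_le_weight x)).ne'
  simpa only [weighted_apply, mul_inv_cancel_left₀ hweight] using (hs x).const_mul (weight x : ℂ)

lemma unweight_weightedAverage (p : ℝ≥0∞) [Fact (1 ≤ p)] {h : ℝ → 𝓢(E, ℂ)}
    (hh : Continuous h) :
    unweight p (weightedAverage h) = ∫ σ in (0 : ℝ)..1, (h σ).toLp p := by
  simp only [weightedAverage, ← unweight_weighted]
  exact ((unweight p).intervalIntegral_comp_comm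
    ((weighted.continuous.comp hh).intervalIntegrable (μ := volume) 0 1)).symm

lemma integral_intervalIntegral_schwartz {h : ℝ → 𝓢(E, ℂ)} (hh : Continuous h) :
    ∫ x, ∫ σ in (0 : ℝ)..1, h σ x = ∫ σ in (0 : ℝ)..1, ∫ x, h σ x := by
  have hint {F : Lp ℂ 1 (volume : Measure E)} {G : E → ℂ} (hFG : F =ᵐ[volume] G) :
      L1.integralCLM F = ∫ x, G x := by
    rw [← L1.integral_eq, L1.integral_eq_integral, integral_congr_ae hFG]
  calc ∫ x, ∫ σ in (0 : ℝ)..1, h σ x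
      = L1.integralCLM (unweight 1 (weightedAverage h)) := by
        rw [hint (coeFn_unweight 1 _)]
        simp only [inv_weight_mul_weightedAverage hh]
    _ = ∫ σ in (0 : ℝ)..1, ∫ x, h σ x := by
        have hcomm := L1.integralCLM.intervalIntegral_comp_comm
          ((by fun_prop : Continuous fun σ => (h σ).toLp 1 volume).intervalIntegrable
            (μ := volume) 0 1)
        rw [unweight_weightedAverage 1 hh]
        refine hcomm.symm.trans (intervalIntegral.integral_congr fun σ _ => ?_)
        exact hint ((h σ).coeFn_toLp 1 volume)

end Weighted

section Pairing

open LineDeriv Laplacian FourierTransform Module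
open scoped ComplexConjugate

variable {E : Type*} [NormedAddCommGroup E] [InnerProductSpace ℝ E] [FiniteDimensional ℝ E]
  [MeasurableSpace E] [BorelSpace E]

/-- The inclusion of the Schwartz functions into `L²`. -/
def toL2 : 𝓢(E, ℂ) →L[ℂ] Lp ℂ 2 (volume : Measure E) := toLpCLM ℂ ℂ 2 volume

lemma inner_toL2 (f g : 𝓢(E, ℂ)) : ⟪toL2 f, toL2 g⟫_ℂ = ∫ x, conj (f x) * g x := by
  simp only [toL2, toLpCLM_apply, inner_toL2_toL2_eq, RCLike.inner_apply']

/-- An operator on Schwartz functions that is symmetric for the `L²` inner product. -/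
def IsL2Symmetric (A : 𝓢(E, ℂ) →L[ℂ] 𝓢(E, ℂ)) : Prop :=
  ∀ f g, ⟪toL2 (A f), toL2 g⟫_ℂ = ⟪toL2 f, toL2 (A g)⟫_ℂ

lemma isL2Symmetric_position (e : E) : IsL2Symmetric (position e) := fun f g => by
  simp only [inner_toL2, position_apply, map_mul, Complex.conj_ofReal]
  congr! 2
  ring

lemma isL2Symmetric_normSqMul : IsL2Symmetric (normSqMul : 𝓢(E, ℂ) →L[ℂ] 𝓢(E, ℂ)) :=
  fun f g => by
    simp only [inner_toL2, normSqMul_apply, map_mul, Complex.conj_ofReal]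
    congr! 2
    ring

lemma inner_toL2_lineDerivOp (e : E) (f g : 𝓢(E, ℂ)) :
    ⟪toL2 (∂_{e} f), toL2 g⟫_ℂ = -⟪toL2 f, toL2 (∂_{e} g)⟫_ℂ := by
  have h := integral_bilinear_lineDerivOp_right_eq_neg_left f g
    ((ContinuousLinearMap.mul ℝ ℂ).comp (Complex.conjCLE : ℂ →L[ℝ] ℂ)) e (μ := volume)
  simp only [inner_toL2]
  simpa using (neg_eq_iff_eq_neg.2 h).symm

lemma inner_toL2_laplacian {ι : Type*} [Fintype ι] (b : OrthonormalBasis ι ℝ E) (f g : 𝓢(E, ℂ)) :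
    ⟪toL2 f, toL2 (Δ g)⟫_ℂ = -∑ i, ⟪toL2 (∂_{b i} f), toL2 (∂_{b i} g)⟫_ℂ := by
  simp only [laplacian_eq_sum b, map_sum, inner_sum, inner_toL2_lineDerivOp,
    Finset.sum_neg_distrib, neg_neg]

lemma re_inner_toL2_laplacian_nonpos (f : 𝓢(E, ℂ)) : (⟪toL2 f, toL2 (Δ f)⟫_ℂ).re ≤ 0 := by
  rw [inner_toL2_laplacian (stdOrthonormalBasis ℝ E), Complex.neg_re, Complex.re_sum]
  exact neg_nonpos.2 (Finset.sum_nonneg fun _ _ => inner_self_nonneg (𝕜 := ℂ))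

lemma isL2Symmetric_laplacian : IsL2Symmetric (laplacianCLM ℂ E 𝓢(E, ℂ)) := fun f g => by
  rw [laplacianCLM_eq, laplacianCLM_eq, ← inner_conj_symm,
    inner_toL2_laplacian (stdOrthonormalBasis ℝ E), inner_toL2_laplacian (stdOrthonormalBasis ℝ E)]
  simp [map_sum]

lemma inner_toL2_euler (f g : 𝓢(E, ℂ)) :
    ⟪toL2 (euler f), toL2 g⟫_ℂ =
      -⟪toL2 f, toL2 (euler g)⟫_ℂ - finrank ℝ E * ⟪toL2 f, toL2 g⟫_ℂ := by
  have hcoord (i) : ⟪toL2 (position (stdOrthonormalBasis ℝ E i)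
      (∂_{stdOrthonormalBasis ℝ E i} f)), toL2 g⟫_ℂ =
      -⟪toL2 f, toL2 (position (stdOrthonormalBasis ℝ E i) (∂_{stdOrthonormalBasis ℝ E i} g))⟫_ℂ
        - ⟪toL2 f, toL2 g⟫_ℂ := by
    rw [isL2Symmetric_position, inner_toL2_lineDerivOp, lineDerivOp_position, map_add,
      inner_add_right, real_inner_self_eq_norm_sq, (stdOrthonormalBasis ℝ E).orthonormal.1 i]
    simp [sub_eq_add_neg, add_comm]
  simp [euler_eq_sum, map_sum, sum_inner, inner_sum, hcoord]

lemma isL2Symmetric_dilation : IsL2Symmetric (dilation : 𝓢(E, ℂ) →L[ℂ] 𝓢(E, ℂ)) :=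
  fun f g => by
    simp only [dilation_apply, map_smul, map_add, inner_smul_left, inner_smul_right,
      inner_add_left, inner_add_right, inner_toL2_euler, map_neg, Complex.conj_I, map_div₀,
      map_natCast, map_ofNat]
    ring

lemma im_inner_toL2_of_commutator {A B : 𝓢(E, ℂ) →L[ℂ] 𝓢(E, ℂ)} (hA : IsL2Symmetric A)
    (hB : IsL2Symmetric B) {c : ℝ} {f g : 𝓢(E, ℂ)}
    (hcomm : A (B f) = B (A f) + (2 * c * Complex.I) • g) :
    (⟪toL2 (A f), toL2 (B f)⟫_ℂ).im = c * (⟪toL2 f, toL2 g⟫_ℂ).re := by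
  have h : ⟪toL2 (A f), toL2 (B f)⟫_ℂ =
      conj ⟪toL2 (A f), toL2 (B f)⟫_ℂ + 2 * c * Complex.I * ⟪toL2 f, toL2 g⟫_ℂ := by
    rw [inner_conj_symm, hB f (A f), hA f (B f), hcomm, map_add, map_smul, inner_add_right,
      inner_smul_right]
  have him := congrArg Complex.im h
  rw [mul_assoc, mul_assoc, ← Complex.ofReal_ofNat, Complex.add_im, Complex.conj_im,
    Complex.im_ofReal_mul, Complex.im_ofReal_mul, Complex.I_mul_im] at him
  linarith

lemma im_inner_normSqMul_laplacian (f : 𝓢(E, ℂ)) :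
    (⟪toL2 (normSqMul f), toL2 (Δ f)⟫_ℂ).im = -2 * (⟪toL2 f, toL2 (dilation f)⟫_ℂ).re := by
  have hcomm : normSqMul (laplacianCLM ℂ E 𝓢(E, ℂ) f) =
      laplacianCLM ℂ E 𝓢(E, ℂ) (normSqMul f) +
        (2 * (-2 : ℝ) * Complex.I) • dilation f := by
    rw [laplacianCLM_eq, laplacianCLM_eq, laplacian_normSqMul]
    push_cast
    module
  simpa only [laplacianCLM_eq] using
    im_inner_toL2_of_commutator isL2Symmetric_normSqMul isL2Symmetric_laplacian hcomm

lemma im_inner_dilation_laplacian (f : 𝓢(E, ℂ)) :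
    (⟪toL2 (dilation f), toL2 (Δ f)⟫_ℂ).im = (⟪toL2 f, toL2 (Δ f)⟫_ℂ).re := by
  have hcomm : dilation (laplacianCLM ℂ E 𝓢(E, ℂ) f) =
      laplacianCLM ℂ E 𝓢(E, ℂ) (dilation f) + (2 * (1 : ℝ) * Complex.I) • Δ f := by
    rw [laplacianCLM_eq, laplacianCLM_eq, laplacian_dilation]
    push_cast
    module
  simpa only [laplacianCLM_eq, one_mul] using
    im_inner_toL2_of_commutator isL2Symmetric_dilation isL2Symmetric_laplacian hcomm

lemma inner_toL2_propagator (σ : ℝ) (f g : 𝓢(E, ℂ)) :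
    ⟪toL2 (propagator σ f), toL2 (propagator σ g)⟫_ℂ = ⟪toL2 f, toL2 g⟫_ℂ := by
  have hfourier (f g : 𝓢(E, ℂ)) : ⟪toL2 (𝓕 f), toL2 (𝓕 g)⟫_ℂ = ⟪toL2 f, toL2 g⟫_ℂ :=
    inner_fourier_toL2_eq f g
  rw [← hfourier, ← hfourier f, fourier_propagator, fourier_propagator, inner_toL2, inner_toL2]
  congr! 2 with ξ
  rw [smulLeftCLM_apply_apply (hasTemperateGrowth_symbol _),
    smulLeftCLM_apply_apply (hasTemperateGrowth_symbol _), smul_eq_mul, smul_eq_mul,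
    map_mul, mul_mul_mul_comm, RCLike.conj_mul, norm_symbol]
  simp

lemma norm_toL2_propagator (σ : ℝ) (f : 𝓢(E, ℂ)) :
    ‖toL2 (propagator σ f)‖ = ‖toL2 f‖ := by
  rw [norm_eq_sqrt_re_inner (𝕜 := ℂ), inner_toL2_propagator, ← norm_eq_sqrt_re_inner]

lemma inner_toL2_propagator_neg (σ : ℝ) (f g : 𝓢(E, ℂ)) :
    ⟪toL2 f, toL2 (propagator (-σ) g)⟫_ℂ = ⟪toL2 (propagator σ f), toL2 g⟫_ℂ := by
  rw [← inner_toL2_propagator σ, propagator_propagator_neg]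

lemma fourier_laplacian_apply (f : 𝓢(E, ℂ)) (ξ : E) :
    𝓕 (Δ f) ξ = -((2 * Real.pi * ‖ξ‖) ^ 2 : ℝ) * 𝓕 f ξ := by
  rw [laplacian_eq_fourierMultiplierCLM, fourierMultiplierCLM_apply]
  simp only [FourierTransform.fourier_smul, FourierTransform.fourier_fourierInv_eq]
  rw [smul_apply, smulLeftCLM_apply_apply (by fun_prop), Complex.real_smul, Complex.real_smul]
  push_cast
  ring

lemma hasDerivAt_toL2_propagator (σ : ℝ) (f : 𝓢(E, ℂ)) :
    HasDerivAt (fun s => toL2 (propagator s f)) (Complex.I • toL2 (Δ (propagator σ f))) σ := by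
  let v (s : ℝ) : 𝓢(E, ℂ) := 𝓕 (Complex.I • Δ (propagator s f))
  have hpoint (s : ℝ) (ξ : E) :
      HasDerivAt (fun r => 𝓕 (propagator r f) ξ) ((weight ξ : ℂ)⁻¹ * weighted (v s) ξ) s := by
    have h := (hasDerivAt_symbol s ξ).mul_const (𝓕 f ξ)
    simp only [v, inv_weight_mul_weighted, FourierTransform.fourier_smul, smul_apply,
      fourier_laplacian_apply, fourier_propagator,
      smulLeftCLM_apply_apply (hasTemperateGrowth_symbol _), smul_eq_mul]
    exact h.congr_deriv (by push_cast; ring)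
  have hcont : Continuous v := by
    have := (((fourierCLM ℂ 𝓢(E, ℂ)).comp (laplacianCLM ℂ E 𝓢(E, ℂ))).continuous.comp
      (continuous_propagator continuous_id (continuous_const (y := f)))).const_smul Complex.I
    refine this.congr fun s => ?_
    simp [v, FourierTransform.fourier_smul]
  have hinv (g : 𝓢(E, ℂ)) : (Lp.fourierTransformₗᵢ E ℂ).symm ((𝓕 g).toLp 2) = toL2 g :=
    (LinearIsometryEquiv.symm_apply_eq _).2 (toLp_fourier_eq g).symm
  have hderiv := ((Lp.fourierTransformₗᵢ E ℂ).symm.toContinuousLinearEquiv.restrictScalars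
    ℝ).hasFDerivAt.comp_hasDerivAt σ (hasDerivAt_toLp 2 (.of_forall hpoint)
      (weighted.continuous.comp hcont).continuousAt)
  simpa [Function.comp_def, unweight_weighted, v, hinv, -FourierTransform.fourier_smul] using hderiv

end Pairing

section Differentiation

lemma hasDerivAt_of_abs_sub_le {F : Type*} [NormedAddCommGroup F] [InnerProductSpace ℂ F]
    {w : ℝ → F} {w' g : F} {φ r : ℝ → ℝ} {c t : ℝ} (hw : HasDerivAt w w' t)
    (hr : Tendsto r (𝓝 t) (𝓝 0))
    (hφ : ∀ᶠ s in 𝓝 t, |φ s - φ t - c * (⟪g, w s - w t⟫_ℂ).re| ≤ r s * ‖w s - w t‖) :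
    HasDerivAt φ (c * (⟪g, w'⟫_ℂ).re) t := by
  let L : F →L[ℝ] ℝ := c • (Complex.reCLM ∘L (innerSL ℂ g).restrictScalars ℝ)
  have hsmall : (fun s => r s * ‖w s - w t‖) =o[𝓝 t] fun s => s - t := by
    simpa using ((Asymptotics.isLittleO_one_iff ℝ).2 hr).mul_isBigO hw.isBigO_sub.norm_left
  have hrem : (fun s => φ s - φ t - L (w s - w t)) =o[𝓝 t] fun s => s - t :=
    (Asymptotics.IsBigO.of_bound 1 (by
      filter_upwards [hφ] with s hs
      simpa [L, inner_sub_right] using hs.trans (le_abs_self _))).trans_isLittleO hsmall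
  have hL : HasDerivAt (fun s => L (w s)) (L w') t := L.hasFDerivAt.comp_hasDerivAt t hw
  rw [hasDerivAt_iff_isLittleO] at hL ⊢
  refine (hrem.add hL).congr_left fun s => ?_
  simp only [L, _root_.smul_apply, ContinuousLinearMap.comp_apply,
    ContinuousLinearMap.coe_restrictScalars', coe_innerSL_apply, Complex.reCLM_apply,
    inner_sub_right, Complex.sub_re, smul_eq_mul]
  ring

variable {E : Type*} [NormedAddCommGroup E] [InnerProductSpace ℝ E] [FiniteDimensional ℝ E]
  [MeasurableSpace E] [BorelSpace E]

lemma IsL2Symmetric.hasDerivAt_re_inner {A : 𝓢(E, ℂ) →L[ℂ] 𝓢(E, ℂ)} (hA : IsL2Symmetric A)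
    {u : ℝ → 𝓢(E, ℂ)} {u' : Lp ℂ 2 (volume : Measure E)} {t : ℝ} (hcont : ContinuousAt u t)
    (hu : HasDerivAt (fun s => toL2 (u s)) u' t) :
    HasDerivAt (fun s => (⟪toL2 (u s), toL2 (A (u s))⟫_ℂ).re)
      (2 * (⟪toL2 (A (u t)), u'⟫_ℂ).re) t := by
  have hsmall : Tendsto (fun s => ‖toL2 (A (u s - u t))‖) (𝓝 t) (𝓝 0) := by
    have h := (toL2.comp A).continuous.norm.continuousAt.comp (hcont.sub_const (u t))
    simpa [ContinuousAt, Function.comp_def] using h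
  refine hasDerivAt_of_abs_sub_le hu hsmall (.of_forall fun s => ?_)
  have hexpand : (⟪toL2 (u s), toL2 (A (u s))⟫_ℂ).re - (⟪toL2 (u t), toL2 (A (u t))⟫_ℂ).re
      - 2 * (⟪toL2 (A (u t)), toL2 (u s) - toL2 (u t)⟫_ℂ).re =
        (⟪toL2 (A (u s - u t)), toL2 (u s) - toL2 (u t)⟫_ℂ).re := by
    have hsymm := inner_re_symm (𝕜 := ℂ) (toL2 (A (u t))) (toL2 (u s))
    simp only [RCLike.re_eq_complex_re, hA (u t)] at hsymm
    simp only [map_sub, inner_sub_left, inner_sub_right, hA (u s), hA (u t), Complex.sub_re]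
    linarith
  rw [hexpand]
  exact (Complex.abs_re_le_norm _).trans (norm_inner_le_norm _ _)

end Differentiation

section Potential

open LineDeriv Laplacian FourierTransform Module
open scoped ComplexConjugate

lemma exists_abs_pow_sub_pow_sub_le (R : ℝ) (n : ℕ) : ∃ C : ℝ, 0 ≤ C ∧
    ∀ a ∈ Icc 0 R, ∀ b ∈ Icc 0 R,
      |a ^ (n + 1) - b ^ (n + 1) - (n + 1) * b ^ n * (a - b)| ≤ C * (a - b) ^ 2 := by
  induction n with
  | zero => exact ⟨0, le_rfl, by simp⟩
  | succ n ih =>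
    obtain ⟨C, hC, h⟩ := ih
    refine ⟨|R| * C + (n + 1) * |R| ^ n, by positivity, fun a ha b hb => ?_⟩
    have hrec : a ^ (n + 1 + 1) - b ^ (n + 1 + 1) - ((n + 1 : ℕ) + 1) * b ^ (n + 1) * (a - b) =
        a * (a ^ (n + 1) - b ^ (n + 1) - (n + 1) * b ^ n * (a - b))
          + (n + 1) * b ^ n * (a - b) ^ 2 := by
      push_cast
      ring
    have ha' : |a| ≤ |R| := abs_le_abs_of_nonneg ha.1 ha.2
    have hb' : |b| ≤ |R| := abs_le_abs_of_nonneg hb.1 hb.2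
    calc _ ≤ |a| * |a ^ (n + 1) - b ^ (n + 1) - (n + 1) * b ^ n * (a - b)|
          + (n + 1) * |b| ^ n * (a - b) ^ 2 := by
          rw [hrec]
          refine (abs_add_le _ _).trans_eq ?_
          have hn : |(n : ℝ) + 1| = n + 1 := abs_of_nonneg n.cast_add_one_pos.le
          simp only [abs_mul, abs_pow, sq_abs, hn]
      _ ≤ |R| * (C * (a - b) ^ 2) + (n + 1) * |R| ^ n * (a - b) ^ 2 := by
          gcongr
          exact h a ha b hb
      _ = _ := by ring

lemma exists_abs_norm_pow_sub_norm_pow_sub_le (R : ℝ) (q : ℕ) : ∃ C : ℝ,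
    ∀ a b : ℂ, ‖a‖ ≤ R → ‖b‖ ≤ R →
      |‖a‖ ^ (2 * q + 2) - ‖b‖ ^ (2 * q + 2)
        - (2 * q + 2) * (‖b‖ ^ (2 * q) * ⟪b, a - b⟫_ℝ)| ≤ C * ‖a - b‖ ^ 2 := by
  obtain ⟨C, hC, h⟩ := exists_abs_pow_sub_pow_sub_le (R ^ 2) q
  refine ⟨C * (2 * R) ^ 2 + (q + 1) * R ^ (2 * q), fun a b ha hb => ?_⟩
  have hsq := h (‖a‖ ^ 2) ⟨by positivity, by gcongr⟩ (‖b‖ ^ 2) ⟨by positivity, by gcongr⟩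
  have hpolar : ⟪b, a - b⟫_ℝ = (‖a‖ ^ 2 - ‖b‖ ^ 2 - ‖a - b‖ ^ 2) / 2 := by
    rw [norm_sub_sq_real, inner_sub_right, real_inner_self_eq_norm_sq, real_inner_comm]
    ring
  have hdiff : (‖a‖ ^ 2 - ‖b‖ ^ 2) ^ 2 ≤ (2 * R) ^ 2 * ‖a - b‖ ^ 2 := by
    rw [sq_sub_sq, mul_pow]
    gcongr ?_ * ?_
    · gcongr
      linarith
    · exact sq_le_sq' (by linarith [norm_sub_norm_le b a, norm_sub_rev a b]) (norm_sub_norm_le a b)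
  calc _ = |((‖a‖ ^ 2) ^ (q + 1) - (‖b‖ ^ 2) ^ (q + 1) -
        (q + 1) * (‖b‖ ^ 2) ^ q * (‖a‖ ^ 2 - ‖b‖ ^ 2)) +
        (q + 1) * ‖b‖ ^ (2 * q) * ‖a - b‖ ^ 2| := by
        rw [hpolar]
        ring_nf
    _ ≤ C * (‖a‖ ^ 2 - ‖b‖ ^ 2) ^ 2 + (q + 1) * ‖b‖ ^ (2 * q) * ‖a - b‖ ^ 2 :=
        (abs_add_le _ _).trans (add_le_add hsq (abs_of_nonneg (by positivity)).le)
    _ ≤ C * ((2 * R) ^ 2 * ‖a - b‖ ^ 2) + (q + 1) * R ^ (2 * q) * ‖a - b‖ ^ 2 := by gcongr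
    _ = _ := by ring

variable {E : Type*} [NormedAddCommGroup E] [InnerProductSpace ℝ E]

lemma norm_apply_le_supSeminorm (f : 𝓢(E, ℂ)) (x : E) : ‖f x‖ ≤ supSeminorm 0 0 f := by
  simpa using one_add_norm_pow_mul_le_supSeminorm (k := 0) (i := 0) le_rfl f x

variable [FiniteDimensional ℝ E]

lemma inner_powMul_euler (q : ℕ) (f : 𝓢(E, ℂ)) (x : E) :
    ⟪f x, euler (powMul q f) x⟫_ℝ = (2 * q + 1) * ⟪euler f x, powMul q f x⟫_ℝ := by
  have hnorm (y : E) : ⟪f y, powMul q f y⟫_ℝ = (‖f y‖ ^ 2) ^ (q + 1) := by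
    rw [powMul_apply, ← Complex.real_smul, inner_smul_right, real_inner_self_eq_norm_sq]
    ring
  have hprod := ((f.hasFDerivAt x).inner ℝ ((powMul q f).hasFDerivAt x)).congr_of_eventuallyEq
    (.of_forall fun y => (hnorm y).symm)
  have hpow := ((f.hasFDerivAt x).norm_sq).pow (q + 1)
  have hleibniz : ⟪f x, euler (powMul q f) x⟫_ℝ + ⟪euler f x, powMul q f x⟫_ℝ =
      (q + 1) * (‖f x‖ ^ 2) ^ q * (2 * ⟪f x, euler f x⟫_ℝ) := by
    simpa [-Complex.inner, fderivInnerCLM_apply, euler_apply, mul_add] using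
      congrArg (fun L : E →L[ℝ] ℝ => L x) (hprod.unique hpow)
  have hpull : ⟪euler f x, powMul q f x⟫_ℝ = (‖f x‖ ^ 2) ^ q * ⟪f x, euler f x⟫_ℝ := by
    rw [powMul_apply, ← Complex.real_smul, inner_smul_right, real_inner_comm, pow_mul]
  rw [hpull] at hleibniz ⊢
  linear_combination hleibniz

variable [MeasurableSpace E] [BorelSpace E]

lemma integrable_real_inner (f g : 𝓢(E, ℂ)) : Integrable fun x => ⟪f x, g x⟫_ℝ := by
  simpa [Complex.inner, mul_comm] using
    ((schwartzMul (schwartzConj f) g).integrable (μ := volume)).re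

lemma re_inner_toL2 (f g : 𝓢(E, ℂ)) : (⟪toL2 f, toL2 g⟫_ℂ).re = ∫ x, ⟪f x, g x⟫_ℝ := by
  have hint : Integrable fun x => conj (f x) * g x :=
    (schwartzMul (schwartzConj f) g).integrable
  rw [inner_toL2, ← RCLike.re_eq_complex_re, ← integral_re hint]
  simp only [Complex.inner, RCLike.re_eq_complex_re, mul_comm]

/-- The potential energy density integrated over space, `∫ |f|^{2q+2}`. -/
def potential (q : ℕ) (f : 𝓢(E, ℂ)) : ℝ := ∫ x, ‖f x‖ ^ (2 * q + 2)

lemma integrable_norm_pow_two_mul_add_two (q : ℕ) (f : 𝓢(E, ℂ)) :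
    Integrable fun x => ‖f x‖ ^ (2 * q + 2) := by
  convert (schwartzMul f (powMul q f)).integrable (μ := volume) |>.norm using 2 with x
  rw [schwartzMul_apply, powMul_apply, norm_mul, norm_mul, Complex.norm_real, norm_pow, norm_norm]
  ring

lemma potential_nonneg (q : ℕ) (f : 𝓢(E, ℂ)) : 0 ≤ potential q f :=
  integral_nonneg fun _ => by positivity

lemma inner_toL2_powMul (q : ℕ) (f : 𝓢(E, ℂ)) :
    ⟪toL2 f, toL2 (powMul q f)⟫_ℂ = potential q f := by
  rw [inner_toL2, potential, ← integral_complex_ofReal]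
  congr! 2 with x
  rw [powMul_apply, mul_left_comm, Complex.conj_mul']
  push_cast
  ring

lemma continuous_potential (q : ℕ) : Continuous (potential q : 𝓢(E, ℂ) → ℝ) := by
  have h (f : 𝓢(E, ℂ)) : potential q f = (⟪toL2 f, toL2 (powMul q f)⟫_ℂ).re := by
    rw [inner_toL2_powMul, Complex.ofReal_re]
  simp only [funext h]
  exact Complex.continuous_re.comp
    (toL2.continuous.inner (toL2.continuous.comp (continuous_powMul q)))

lemma im_inner_normSqMul_powMul (q : ℕ) (f : 𝓢(E, ℂ)) :
    (⟪toL2 (normSqMul f), toL2 (powMul q f)⟫_ℂ).im = 0 := by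
  have hreal : ⟪toL2 (normSqMul f), toL2 (powMul q f)⟫_ℂ =
      ((∫ x, ‖x‖ ^ 2 * ‖f x‖ ^ (2 * q + 2) : ℝ) : ℂ) := by
    rw [inner_toL2, ← integral_complex_ofReal]
    congr! 2 with x
    rw [normSqMul_apply, powMul_apply, map_mul, Complex.conj_ofReal, mul_mul_mul_comm,
      Complex.conj_mul']
    push_cast
    ring
  rw [hreal, Complex.ofReal_im]

lemma re_inner_euler_powMul (q : ℕ) (f : 𝓢(E, ℂ)) :
    (2 * q + 2) * (⟪toL2 (euler f), toL2 (powMul q f)⟫_ℂ).re = -(finrank ℝ E * potential q f) := by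
  have h := congrArg Complex.re (inner_toL2_euler f (powMul q f))
  have hpow : (⟪toL2 f, toL2 (euler (powMul q f))⟫_ℂ).re =
      (2 * q + 1) * (⟪toL2 (euler f), toL2 (powMul q f)⟫_ℂ).re := by
    simp only [re_inner_toL2, inner_powMul_euler, integral_const_mul]
  rw [inner_toL2_powMul, Complex.sub_re, Complex.neg_re, hpow, ← Complex.ofReal_natCast,
    Complex.re_ofReal_mul, Complex.ofReal_re] at h
  linarith

lemma im_inner_dilation_powMul (q : ℕ) (f : 𝓢(E, ℂ)) :
    (⟪toL2 (dilation f), toL2 (powMul q f)⟫_ℂ).im =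
      finrank ℝ E * q / (2 * q + 2) * potential q f := by
  have h := re_inner_euler_powMul q f
  rw [dilation_apply, map_smul, map_add, map_smul, inner_smul_left, inner_add_left, inner_smul_left,
    inner_toL2_powMul]
  simp only [map_neg, Complex.conj_I, neg_neg, map_div₀, map_natCast, map_ofNat, Complex.I_mul_im,
    Complex.add_re]
  rw [← Complex.ofReal_natCast, ← Complex.ofReal_ofNat, ← Complex.ofReal_div, ← Complex.ofReal_mul,
    Complex.ofReal_re]
  field_simp
  linarith

lemma exists_abs_potential_sub_potential_sub_le (R : ℝ) (q : ℕ) : ∃ C : ℝ,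
    ∀ f g : 𝓢(E, ℂ), supSeminorm 0 0 f ≤ R → supSeminorm 0 0 g ≤ R →
      |potential q f - potential q g - (2 * q + 2) * (⟪toL2 (powMul q g), toL2 (f - g)⟫_ℂ).re|
        ≤ C * ‖toL2 (f - g)‖ ^ 2 := by
  obtain ⟨C, hC⟩ := exists_abs_norm_pow_sub_norm_pow_sub_le R q
  refine ⟨C, fun f g hf hg => ?_⟩
  have hpot (f : 𝓢(E, ℂ)) := integrable_norm_pow_two_mul_add_two q f
  have hinner : Integrable fun x => ⟪powMul q g x, (f - g) x⟫_ℝ := integrable_real_inner _ _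
  have hdiff : Integrable fun x => ‖f x‖ ^ (2 * q + 2) - ‖g x‖ ^ (2 * q + 2) :=
    (hpot f).sub (hpot g)
  have hsq : Integrable fun x => ⟪(f - g) x, (f - g) x⟫_ℝ := integrable_real_inner _ _
  have hnorm : ‖toL2 (f - g)‖ ^ 2 = ∫ x, ⟪(f - g) x, (f - g) x⟫_ℝ := by
    rw [← re_inner_toL2, ← RCLike.re_eq_complex_re, inner_self_eq_norm_sq]
  rw [hnorm, re_inner_toL2, potential, potential, ← integral_const_mul, ← integral_const_mul,
    ← integral_sub (hpot f) (hpot g), ← integral_sub hdiff (hinner.const_mul _)]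
  refine abs_integral_le_integral_abs.trans (integral_mono
    (hdiff.sub (hinner.const_mul _)).abs (hsq.const_mul C) fun x => ?_)
  have h := hC (f x) (g x) ((norm_apply_le_supSeminorm f x).trans hf)
    ((norm_apply_le_supSeminorm g x).trans hg)
  simpa only [powMul_apply, ← Complex.real_smul, real_inner_smul_left, sub_apply,
    real_inner_self_eq_norm_sq] using h

lemma hasDerivAt_potential (q : ℕ) {w : ℝ → 𝓢(E, ℂ)} {w' : Lp ℂ 2 (volume : Measure E)} {t : ℝ}
    (hcont : ContinuousAt w t) (hw : HasDerivAt (fun s => toL2 (w s)) w' t) :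
    HasDerivAt (fun s => potential q (w s))
      ((2 * q + 2) * (⟪toL2 (powMul q (w t)), w'⟫_ℂ).re) t := by
  obtain ⟨C, hC⟩ := exists_abs_potential_sub_potential_sub_le (E := E) (supSeminorm 0 0 (w t) + 1) q
  have hsmall : Tendsto (fun s => C * ‖toL2 (w s) - toL2 (w t)‖) (𝓝 t) (𝓝 0) := by
    have h := (hw.continuousAt.sub_const (toL2 (w t))).norm.const_mul C
    simpa using h
  refine hasDerivAt_of_abs_sub_le hw hsmall ?_
  have hnear := ((continuous_supSeminorm 0 0).continuousAt.comp hcont).eventually_le_const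
    (lt_add_one (supSeminorm 0 0 (w t)))
  filter_upwards [hnear] with s hs
  simpa only [map_sub, mul_assoc, ← sq] using hC _ _ hs (lt_add_one _).le

lemma hasDerivAt_potential_propagator (q : ℕ) (f : 𝓢(E, ℂ)) (σ : ℝ) :
    HasDerivAt (fun s => potential q (propagator s f)) ((2 * q + 2) *
      (⟪toL2 (Δ (propagator σ f)), toL2 (powMul q (propagator σ f))⟫_ℂ).im) σ := by
  have h := hasDerivAt_potential q (continuous_propagator continuous_id
    (continuous_const (y := f))).continuousAt (hasDerivAt_toL2_propagator σ f)
  rwa [inner_smul_right, ← inner_conj_symm, Complex.I_mul_re, Complex.conj_im, neg_neg] at h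

end Potential

section Average

open LineDeriv Laplacian FourierTransform Module
open scoped ComplexConjugate

variable {E : Type*} [NormedAddCommGroup E] [InnerProductSpace ℝ E] [FiniteDimensional ℝ E]
  [MeasurableSpace E] [BorelSpace E]

/-- The integrand `e^{-iσΔ}[|e^{iσΔ} f|^{2q} e^{iσΔ} f]` of the Gabitov–Turitsyn nonlinearity. -/
def conjPowMul (q : ℕ) (f : 𝓢(E, ℂ)) (σ : ℝ) : 𝓢(E, ℂ) :=
  propagator (-σ) (powMul q (propagator σ f))

lemma continuous_uncurry_conjPowMul (q : ℕ) :
    Continuous (conjPowMul q : 𝓢(E, ℂ) → ℝ → 𝓢(E, ℂ)).uncurry := by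
  have hpow := continuous_powMul (E := E) q
  simp only [Function.uncurry_def, conjPowMul]
  fun_prop

lemma continuous_conjPowMul (q : ℕ) (f : 𝓢(E, ℂ)) : Continuous (conjPowMul q f) :=
  (continuous_uncurry_conjPowMul q).uncurry_left f

/-- The Gabitov–Turitsyn nonlinearity as an element of `L²`, where it is the gradient of
`avgPotential`. -/
def avgPowMul (q : ℕ) (f : 𝓢(E, ℂ)) : Lp ℂ 2 (volume : Measure E) :=
  ∫ σ in (0 : ℝ)..1, toL2 (conjPowMul q f σ)

/-- The potential averaged along the free flow, `∫₀¹ ∫ |e^{iσΔ} f|^{2q+2} dσ`. -/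
def avgPotential (q : ℕ) (f : 𝓢(E, ℂ)) : ℝ :=
  ∫ σ in (0 : ℝ)..1, potential q (propagator σ f)

lemma avgPotential_nonneg (q : ℕ) (f : 𝓢(E, ℂ)) : 0 ≤ avgPotential q f :=
  intervalIntegral.integral_nonneg zero_le_one fun _ _ => potential_nonneg _ _

lemma integral_mul_potential_propagator_nonneg (q : ℕ) (f : 𝓢(E, ℂ)) :
    0 ≤ ∫ σ in (0 : ℝ)..1, σ * potential q (propagator σ f) :=
  intervalIntegral.integral_nonneg zero_le_one fun _ hσ => mul_nonneg hσ.1 (potential_nonneg _ _)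

lemma continuous_potential_propagator (q : ℕ) (f : 𝓢(E, ℂ)) :
    Continuous fun σ => potential q (propagator σ f) :=
  (continuous_potential q).comp (continuous_propagator continuous_id continuous_const)

lemma continuous_inner_propagator_powMul (q : ℕ) (f g : 𝓢(E, ℂ)) :
    Continuous fun σ => ⟪toL2 (propagator σ g), toL2 (powMul q (propagator σ f))⟫_ℂ := by
  have hpow := continuous_powMul (E := E) q
  fun_prop

lemma inner_avgPowMul (q : ℕ) (f g : 𝓢(E, ℂ)) : ⟪toL2 g, avgPowMul q f⟫_ℂ =
    ∫ σ in (0 : ℝ)..1, ⟪toL2 (propagator σ g), toL2 (powMul q (propagator σ f))⟫_ℂ := by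
  have h := (innerSL ℂ (toL2 g)).intervalIntegral_comp_comm
    ((toL2.continuous.comp (continuous_conjPowMul q f)).intervalIntegrable (μ := volume) 0 1)
  simpa only [innerSL_apply_apply, Function.comp_apply, conjPowMul, inner_toL2_propagator_neg,
    avgPowMul]
    using h.symm

lemma re_inner_avgPowMul (q : ℕ) (f g : 𝓢(E, ℂ)) : (⟪toL2 g, avgPowMul q f⟫_ℂ).re =
    ∫ σ in (0 : ℝ)..1, (⟪toL2 (propagator σ g), toL2 (powMul q (propagator σ f))⟫_ℂ).re := by
  rw [inner_avgPowMul]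
  exact (Complex.reCLM.intervalIntegral_comp_comm
    ((continuous_inner_propagator_powMul q f g).intervalIntegrable (μ := volume) 0 1)).symm

lemma im_inner_avgPowMul (q : ℕ) (f g : 𝓢(E, ℂ)) : (⟪toL2 g, avgPowMul q f⟫_ℂ).im =
    ∫ σ in (0 : ℝ)..1, (⟪toL2 (propagator σ g), toL2 (powMul q (propagator σ f))⟫_ℂ).im := by
  rw [inner_avgPowMul]
  exact (Complex.imCLM.intervalIntegral_comp_comm
    ((continuous_inner_propagator_powMul q f g).intervalIntegrable (μ := volume) 0 1)).symm

lemma exists_eventually_supSeminorm_propagator_le (g : 𝓢(E, ℂ)) : ∃ R : ℝ,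
    ∀ᶠ f in 𝓝 g, ∀ σ ∈ Icc (0 : ℝ) 1, supSeminorm 0 0 (propagator σ f) ≤ R := by
  have hcont : Continuous fun z : 𝓢(E, ℂ) × ℝ => supSeminorm 0 0 (propagator z.2 z.1) :=
    (continuous_supSeminorm 0 0).comp (continuous_propagator continuous_snd continuous_fst)
  obtain ⟨R, hR⟩ := isCompact_Icc.bddAbove_image (K := Icc (0 : ℝ) 1)
    (hcont.comp (Continuous.prodMk_right g)).continuousOn
  refine ⟨R + 1, isCompact_Icc.eventually_forall_of_forall_eventually fun σ hσ => ?_⟩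
  exact hcont.continuousAt.eventually_le_const
    ((hR (mem_image_of_mem _ hσ)).trans_lt (lt_add_one R))

lemma exists_eventually_abs_avgPotential_sub_le (q : ℕ) (g : 𝓢(E, ℂ)) : ∃ C : ℝ,
    ∀ᶠ f in 𝓝 g,
      |avgPotential q f - avgPotential q g - (2 * q + 2) * (⟪avgPowMul q g, toL2 (f - g)⟫_ℂ).re|
        ≤ C * ‖toL2 (f - g)‖ ^ 2 := by
  obtain ⟨R, hR⟩ := exists_eventually_supSeminorm_propagator_le g
  obtain ⟨C, hC⟩ := exists_abs_potential_sub_potential_sub_le (E := E) R q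
  refine ⟨C, ?_⟩
  filter_upwards [hR] with f hf
  have hpot (f : 𝓢(E, ℂ)) : IntervalIntegrable (fun σ => potential q (propagator σ f))
      volume 0 1 := (continuous_potential_propagator q f).intervalIntegrable 0 1
  have hpair : IntervalIntegrable (fun σ => (2 * (q : ℝ) + 2) *
      (⟪toL2 (propagator σ (f - g)), toL2 (powMul q (propagator σ g))⟫_ℂ).re) volume 0 1 :=
    (continuous_const.mul (Complex.continuous_re.comp
      (continuous_inner_propagator_powMul q g (f - g)))).intervalIntegrable 0 1
  have hsymm : (⟪avgPowMul q g, toL2 (f - g)⟫_ℂ).re = (⟪toL2 (f - g), avgPowMul q g⟫_ℂ).re :=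
    inner_re_symm (𝕜 := ℂ) _ _
  rw [hsymm, re_inner_avgPowMul, avgPotential, avgPotential, ← intervalIntegral.integral_const_mul,
    ← intervalIntegral.integral_sub (hpot f) (hpot g),
    ← intervalIntegral.integral_sub ((hpot f).sub (hpot g)) hpair]
  have hbound (σ : ℝ) (hσ : σ ∈ uIoc (0 : ℝ) 1) : ‖potential q (propagator σ f)
      - potential q (propagator σ g) - (2 * q + 2) *
        (⟪toL2 (propagator σ (f - g)), toL2 (powMul q (propagator σ g))⟫_ℂ).re‖
      ≤ C * ‖toL2 (f - g)‖ ^ 2 := by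
    have hσ' : σ ∈ Icc (0 : ℝ) 1 := Ioc_subset_Icc_self (by rwa [uIoc_of_le zero_le_one] at hσ)
    have h := hC _ _ (hf σ hσ') (hR.self_of_nhds σ hσ')
    rwa [← map_sub, norm_toL2_propagator, ← RCLike.re_eq_complex_re, inner_re_symm] at h
  simpa using intervalIntegral.norm_integral_le_of_norm_le_const hbound

lemma hasDerivAt_avgPotential (q : ℕ) {u : ℝ → 𝓢(E, ℂ)} {u' : Lp ℂ 2 (volume : Measure E)} {t : ℝ}
    (hcont : ContinuousAt u t) (hu : HasDerivAt (fun s => toL2 (u s)) u' t) :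
    HasDerivAt (fun s => avgPotential q (u s))
      ((2 * q + 2) * (⟪avgPowMul q (u t), u'⟫_ℂ).re) t := by
  obtain ⟨C, hC⟩ := exists_eventually_abs_avgPotential_sub_le q (u t)
  have hsmall : Tendsto (fun s => C * ‖toL2 (u s) - toL2 (u t)‖) (𝓝 t) (𝓝 0) := by
    have h := (hu.continuousAt.sub_const (toL2 (u t))).norm.const_mul C
    simpa using h
  refine hasDerivAt_of_abs_sub_le hu hsmall ?_
  filter_upwards [hcont.eventually hC] with s hs
  simpa only [map_sub, mul_assoc, ← sq] using hs

lemma im_inner_propagator_dilation_powMul (q : ℕ) (f : 𝓢(E, ℂ)) (σ : ℝ) :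
    (⟪toL2 (propagator σ (dilation f)), toL2 (powMul q (propagator σ f))⟫_ℂ).im =
      finrank ℝ E * q / (2 * q + 2) * potential q (propagator σ f) +
        2 * (σ * (⟪toL2 (Δ (propagator σ f)), toL2 (powMul q (propagator σ f))⟫_ℂ).im) := by
  rw [propagator_dilation, map_add, map_smul, inner_add_left, inner_smul_left, Complex.add_im,
    im_inner_dilation_powMul, ← Complex.ofReal_ofNat, ← Complex.ofReal_mul, Complex.conj_ofReal,
    Complex.im_ofReal_mul, mul_assoc]

lemma im_inner_propagator_normSqMul_powMul (q : ℕ) (f : 𝓢(E, ℂ)) (σ : ℝ) :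
    (⟪toL2 (propagator σ (normSqMul f)), toL2 (powMul q (propagator σ f))⟫_ℂ).im =
      -(4 * (finrank ℝ E * q / (2 * q + 2))) * (σ * potential q (propagator σ f)) -
        4 * (σ ^ 2 * (⟪toL2 (Δ (propagator σ f)), toL2 (powMul q (propagator σ f))⟫_ℂ).im) := by
  rw [propagator_normSqMul, map_sub, map_sub, map_smul, map_smul, inner_sub_left, inner_sub_left,
    inner_smul_left, inner_smul_left, Complex.sub_im, Complex.sub_im, im_inner_normSqMul_powMul,
    ← Complex.ofReal_ofNat, ← Complex.ofReal_pow, ← Complex.ofReal_mul, ← Complex.ofReal_mul,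
    Complex.conj_ofReal, Complex.conj_ofReal, Complex.im_ofReal_mul, Complex.im_ofReal_mul,
    im_inner_dilation_powMul]
  ring

lemma continuous_im_inner_laplacian_powMul (q : ℕ) (f : 𝓢(E, ℂ)) : Continuous fun σ =>
    (⟪toL2 (Δ (propagator σ f)), toL2 (powMul q (propagator σ f))⟫_ℂ).im := by
  simp only [← propagator_laplacian]
  exact Complex.continuous_im.comp (continuous_inner_propagator_powMul q f (Δ f))

lemma integral_pow_succ_mul_im_inner_laplacian_powMul (q n : ℕ) (f : 𝓢(E, ℂ)) :
    (2 * q + 2) * ∫ σ in (0 : ℝ)..1, σ ^ (n + 1) *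
      (⟪toL2 (Δ (propagator σ f)), toL2 (powMul q (propagator σ f))⟫_ℂ).im =
        potential q (propagator 1 f)
          - (n + 1) * ∫ σ in (0 : ℝ)..1, σ ^ n * potential q (propagator σ f) := by
  have hderiv (σ : ℝ) : HasDerivAt (fun r : ℝ => r ^ (n + 1)) ((n + 1) * σ ^ n) σ := by
    simpa using hasDerivAt_pow (n + 1) σ
  have h := intervalIntegral.integral_mul_deriv_eq_deriv_mul (a := 0) (b := 1)
    (fun σ _ => hderiv σ) (fun σ _ => hasDerivAt_potential_propagator q f σ)
    ((continuous_const.mul (continuous_pow n)).intervalIntegrable 0 1)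
    ((continuous_const.mul (continuous_im_inner_laplacian_powMul q f)).intervalIntegrable 0 1)
  simpa only [mul_left_comm _ (2 * (q : ℝ) + 2), mul_assoc, intervalIntegral.integral_const_mul,
    one_pow, one_mul, zero_pow n.succ_ne_zero, zero_mul, sub_zero] using h

lemma im_inner_dilation_avgPowMul (q : ℕ) (f : 𝓢(E, ℂ)) :
    (⟪toL2 (dilation f), avgPowMul q f⟫_ℂ).im =
      ((finrank ℝ E * q - 2) * avgPotential q f + 2 * potential q (propagator 1 f)) /
        (2 * q + 2) := by
  have hparts := integral_pow_succ_mul_im_inner_laplacian_powMul q 0 f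
  have hpot := continuous_potential_propagator q f
  have hlap := continuous_im_inner_laplacian_powMul q f
  simp only [im_inner_avgPowMul, im_inner_propagator_dilation_powMul]
  rw [intervalIntegral.integral_add (Continuous.intervalIntegrable (by fun_prop) 0 1)
      (Continuous.intervalIntegrable (by fun_prop) 0 1),
    intervalIntegral.integral_const_mul, intervalIntegral.integral_const_mul, ← avgPotential]
  simp only [zero_add, pow_one, pow_zero, one_mul, Nat.cast_zero] at hparts
  rw [← avgPotential] at hparts
  field_simp
  linear_combination (2 : ℝ) * hparts

lemma im_inner_normSqMul_avgPowMul (q : ℕ) (f : 𝓢(E, ℂ)) :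
    (⟪toL2 (normSqMul f), avgPowMul q f⟫_ℂ).im =
      -(4 * ((finrank ℝ E * q - 2) * (∫ σ in (0 : ℝ)..1, σ * potential q (propagator σ f)) +
        potential q (propagator 1 f))) / (2 * q + 2) := by
  have hparts := integral_pow_succ_mul_im_inner_laplacian_powMul q 1 f
  have hpot := continuous_potential_propagator q f
  have hlap := continuous_im_inner_laplacian_powMul q f
  simp only [im_inner_avgPowMul, im_inner_propagator_normSqMul_powMul]
  rw [intervalIntegral.integral_sub (Continuous.intervalIntegrable (by fun_prop) 0 1)
      (Continuous.intervalIntegrable (by fun_prop) 0 1),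
    intervalIntegral.integral_const_mul, intervalIntegral.integral_const_mul]
  simp only [one_add_one_eq_two, pow_one, Nat.cast_one] at hparts
  field_simp
  linear_combination -hparts

end Average

section Functionals

open LineDeriv Laplacian FourierTransform Module
open scoped ComplexConjugate

variable {d : ℕ}

lemma freePropagator_eq (σ : ℝ) (f : 𝓢(Space d, ℂ)) : freePropagator σ f = propagator σ f := by
  rw [propagator_apply, fourierInv_coe, freePropagator]
  congr 1 with ξ
  rw [smulLeftCLM_apply_apply (hasTemperateGrowth_symbol _), symbol, smul_eq_mul, fourier_coe]

lemma nonlinearity_eq (q : ℕ) (f : 𝓢(Space d, ℂ)) (x : Space d) :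
    nonlinearity (2 * q) f x = (weight x : ℂ)⁻¹ * weightedAverage (conjPowMul q f) x := by
  have hpow (σ : ℝ) : (fun y => ((‖propagator σ f y‖ ^ (2 * q) : ℝ) : ℂ) * propagator σ f y) =
      powMul q (propagator σ f) := by
    ext y
    rw [powMul_apply]
  rw [inv_weight_mul_weightedAverage (continuous_conjPowMul q f), nonlinearity]
  simp only [freePropagator_eq, hpow, conjPowMul]

lemma variance_eq (f : 𝓢(Space d, ℂ)) :
    variance f = (⟪toL2 f, toL2 (normSqMul f)⟫_ℂ).re := by
  rw [variance, re_inner_toL2]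
  congr! 2 with x
  rw [normSqMul_apply, ← Complex.real_smul, inner_smul_right, real_inner_self_eq_norm_sq]

lemma vDotOne_eq (f : 𝓢(Space d, ℂ)) :
    vDotOne f = 4 * (⟪toL2 f, toL2 (dilation f)⟫_ℂ).re := by
  have heuler (x : Space d) : ∑ j, ((x j : ℝ) : ℂ) * partialDeriv j f x = euler f x := by
    have hx := congrArg (fderiv ℝ f x) ((EuclideanSpace.basisFun (Fin d) ℝ).sum_repr x)
    rw [map_sum] at hx
    simpa [euler_apply, partialDeriv] using hx
  have hself : (⟪toL2 f, toL2 f⟫_ℂ).im = 0 := inner_self_im (𝕜 := ℂ) _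
  simp only [vDotOne, heuler, ← inner_toL2]
  rw [dilation_apply, map_smul, map_add, map_smul, inner_smul_right, inner_add_right,
    inner_smul_right]
  simp [Complex.mul_im, hself, -inner_self_eq_norm_sq_to_K]

lemma integral_intervalIntegral_norm_freePropagator_pow (q : ℕ) (f : 𝓢(Space d, ℂ)) :
    ∫ x, ∫ σ in (0 : ℝ)..1, ‖freePropagator σ f x‖ ^ (2 * q + 2) = avgPotential q f := by
  have hcont : Continuous fun σ =>
      schwartzMul (schwartzConj (propagator σ f)) (powMul q (propagator σ f)) := by
    have hprop := continuous_propagator continuous_id (continuous_const (y := f))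
    exact continuous_schwartzMul (schwartzConj.continuous.comp hprop)
      ((continuous_powMul q).comp hprop)
  have happly (σ : ℝ) (x : Space d) :
      schwartzMul (schwartzConj (propagator σ f)) (powMul q (propagator σ f)) x =
        ((‖propagator σ f x‖ ^ (2 * q + 2) : ℝ) : ℂ) := by
    rw [schwartzMul_apply, schwartzConj_apply, powMul_apply, mul_left_comm, Complex.conj_mul']
    push_cast
    ring
  have hswap := integral_intervalIntegral_schwartz hcont
  simp only [happly, integral_complex_ofReal, intervalIntegral.integral_ofReal] at hswap
  simp only [freePropagator_eq]
  exact_mod_cast hswap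

lemma energy_eq (q : ℕ) (γ : ℝ) (f : 𝓢(Space d, ℂ)) :
    energy (2 * q) γ f =
      γ / 2 * (⟪toL2 f, toL2 (Δ f)⟫_ℂ).re + avgPotential q f / (2 * q + 2) := by
  have hkinetic : ∫ x, ∑ j, ‖partialDeriv j f x‖ ^ 2 = -(⟪toL2 f, toL2 (Δ f)⟫_ℂ).re := by
    rw [inner_toL2_laplacian (EuclideanSpace.basisFun (Fin d) ℝ), Complex.neg_re, neg_neg,
      Complex.re_sum]
    simp only [re_inner_toL2]
    rw [← integral_finsetSum _ fun j _ => integrable_real_inner _ _]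
    simp only [real_inner_self_eq_norm_sq, lineDerivOp_apply_eq_fderiv, partialDeriv,
      EuclideanSpace.basisFun_apply]
  rw [energy, hkinetic, integral_intervalIntegral_norm_freePropagator_pow]
  push_cast
  ring

end Functionals

section Flow

open LineDeriv Laplacian FourierTransform Module
open scoped ComplexConjugate

variable {d q : ℕ} {γ : ℝ} {u₀ : 𝓢(Space d, ℂ)} {I : Set ℝ} {u : ℝ → 𝓢(Space d, ℂ)} {t : ℝ}

lemma IsSolution.continuousAt (hu : IsSolution (2 * q) γ u₀ I u) (ht : t ∈ I) :
    ContinuousAt u t := hu.continuousOn.continuousAt (hu.isOpen.mem_nhds ht)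

lemma IsSolution.hasDerivAt_toL2 (hu : IsSolution (2 * q) γ u₀ I u) (ht : t ∈ I) :
    HasDerivAt (fun s => toL2 (u s))
      (Complex.I • ((γ : ℂ) • toL2 (Δ (u t)) + avgPowMul q (u t))) t := by
  have hlap := (weighted.comp (laplacianCLM ℂ (Space d) 𝓢(Space d, ℂ))).continuous
  have havg := continuous_weightedAverage (continuous_uncurry_conjPowMul (E := Space d) q)
  have h := hasDerivAt_toLp 2 (u := u) (v := fun s => Complex.I •
      ((γ : ℂ) • weighted (laplacianCLM ℂ (Space d) 𝓢(Space d, ℂ) (u s)) +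
        weightedAverage (conjPowMul q (u s))))
    (by
      filter_upwards [hu.isOpen.mem_nhds ht] with s hs x
      refine (hu.equation s hs x).congr_deriv ?_
      rw [nonlinearity_eq, ← laplacian_apply, ← inv_weight_mul_weighted (Δ (u s))]
      simp only [laplacianCLM_eq, BoundedContinuousFunction.smul_apply,
        BoundedContinuousFunction.add_apply, smul_eq_mul]
      ring)
    ((((hlap.const_smul (γ : ℂ)).add havg).const_smul Complex.I).continuousAt.comp
      (hu.continuousAt ht))
  rw [map_smul, map_add, map_smul, unweight_weighted,
    unweight_weightedAverage 2 (continuous_conjPowMul q (u t)), laplacianCLM_eq] at h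
  exact h

lemma IsSolution.hasDerivAt_re_inner (hu : IsSolution (2 * q) γ u₀ I u) (ht : t ∈ I)
    {A : 𝓢(Space d, ℂ) →L[ℂ] 𝓢(Space d, ℂ)} (hA : IsL2Symmetric A) :
    HasDerivAt (fun s => (⟪toL2 (u s), toL2 (A (u s))⟫_ℂ).re)
      (-2 * (γ * (⟪toL2 (A (u t)), toL2 (Δ (u t))⟫_ℂ).im +
        (⟪toL2 (A (u t)), avgPowMul q (u t)⟫_ℂ).im)) t := by
  refine (hA.hasDerivAt_re_inner (hu.continuousAt ht) (hu.hasDerivAt_toL2 ht)).congr_deriv ?_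
  rw [inner_smul_right, inner_add_right, inner_smul_right, Complex.I_mul_re, Complex.add_im,
    Complex.im_ofReal_mul]
  ring

lemma IsSolution.hasDerivAt_energy (hu : IsSolution (2 * q) γ u₀ I u) (ht : t ∈ I) :
    HasDerivAt (fun s => energy (2 * q) γ (u s)) 0 t := by
  have hkinetic := hu.hasDerivAt_re_inner ht isL2Symmetric_laplacian
  simp only [laplacianCLM_eq] at hkinetic
  have hpotential := hasDerivAt_avgPotential q (hu.continuousAt ht) (hu.hasDerivAt_toL2 ht)
  have hself (f : Lp ℂ 2 (volume : Measure (Space d))) : (⟪f, f⟫_ℂ).im = 0 :=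
    inner_self_im (𝕜 := ℂ) f
  have hsymm : (⟪avgPowMul q (u t), toL2 (Δ (u t))⟫_ℂ).im =
      -(⟪toL2 (Δ (u t)), avgPowMul q (u t)⟫_ℂ).im := inner_im_symm (𝕜 := ℂ) _ _
  simp only [energy_eq]
  refine ((hkinetic.const_mul (γ / 2)).add
    (hpotential.div_const (2 * (q : ℝ) + 2))).congr_deriv ?_
  rw [inner_smul_right, inner_add_right, inner_smul_right, Complex.I_mul_re, Complex.add_im,
    Complex.im_ofReal_mul, hself (toL2 (Δ (u t))), hself (avgPowMul q (u t)), hsymm]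
  field_simp
  ring

lemma IsSolution.energy_eq_initial (hu : IsSolution (2 * q) γ u₀ I u) (ht : t ∈ I) :
    energy (2 * q) γ (u t) = energy (2 * q) γ u₀ := by
  rw [← hu.initial]
  exact hu.ordConnected.convex.is_const_of_fderivWithin_eq_zero (𝕜 := ℝ)
    (f := fun s => energy (2 * q) γ (u s))
    (fun s hs => (hu.hasDerivAt_energy hs).differentiableAt.differentiableWithinAt)
    (fun s hs => by
      rw [(hu.hasDerivAt_energy hs).hasFDerivAt.hasFDerivWithinAt.fderivWithin
        (hu.isOpen.uniqueDiffWithinAt hs)]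
      simp) ht hu.zero_mem

lemma IsSolution.hasDerivAt_variance (hu : IsSolution (2 * q) γ u₀ I u) (ht : t ∈ I) :
    HasDerivAt (fun s => variance (u s)) (γ * vDotOne (u t) +
      8 * ((d * q - 2) * (∫ σ in (0 : ℝ)..1, σ * potential q (propagator σ (u t))) +
        potential q (propagator 1 (u t))) / (2 * q + 2)) t := by
  simp only [variance_eq, vDotOne_eq]
  refine (hu.hasDerivAt_re_inner ht isL2Symmetric_normSqMul).congr_deriv ?_
  rw [im_inner_normSqMul_laplacian, im_inner_normSqMul_avgPowMul, finrank_euclideanSpace_fin]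
  ring

lemma IsSolution.hasDerivAt_vDotOne (hu : IsSolution (2 * q) γ u₀ I u) (ht : t ∈ I) :
    HasDerivAt (fun s => vDotOne (u s)) (-16 * energy (2 * q) γ u₀ -
      8 * ((d * q - 4) * avgPotential q (u t) + 2 * potential q (propagator 1 (u t))) /
        (2 * q + 2)) t := by
  simp only [vDotOne_eq]
  refine ((hu.hasDerivAt_re_inner ht isL2Symmetric_dilation).const_mul 4).congr_deriv ?_
  rw [← hu.energy_eq_initial ht, energy_eq, im_inner_dilation_laplacian,
    im_inner_dilation_avgPowMul, finrank_euclideanSpace_fin]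
  ring

end Flow

section Bounds

variable {d q : ℕ} {γ : ℝ} {u₀ : 𝓢(Space d, ℂ)} {I : Set ℝ} {u : ℝ → 𝓢(Space d, ℂ)} {t : ℝ}

lemma le_of_hasDerivAt_nonneg {φ φ' : ℝ → ℝ} {a b : ℝ} (hab : a ≤ b)
    (hφ : ∀ s ∈ Icc a b, HasDerivAt φ (φ' s) s) (hφ' : ∀ s ∈ Icc a b, 0 ≤ φ' s) : φ a ≤ φ b :=
  monotoneOn_of_hasDerivWithinAt_nonneg (convex_Icc a b)
    (fun s hs => (hφ s hs).continuousAt.continuousWithinAt)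
    (fun s hs => (hφ s (interior_subset hs)).hasDerivWithinAt)
    (fun s hs => hφ' s (interior_subset hs)) (left_mem_Icc.2 hab) (right_mem_Icc.2 hab) hab

lemma avgPotential_div_le_energy (hγ : γ ≤ 0) (f : 𝓢(Space d, ℂ)) :
    avgPotential q f / (2 * q + 2) ≤ energy (2 * q) γ f := by
  rw [energy_eq]
  linarith [mul_nonneg_of_nonpos_of_nonpos (by linarith : γ / 2 ≤ 0)
    (re_inner_toL2_laplacian_nonpos f)]

lemma IsSolution.vDotOne_ge (hu : IsSolution (2 * q) γ u₀ I u) (hdq : 4 ≤ (d * q : ℝ))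
    (ht : t ∈ I) (ht0 : t ≤ 0) :
    vDotOne u₀ - 16 * energy (2 * q) γ u₀ * t ≤ vDotOne (u t) := by
  have hsub : Icc t 0 ⊆ I := hu.ordConnected.out ht hu.zero_mem
  have hle := le_of_hasDerivAt_nonneg ht0
    (φ := fun s => -(vDotOne (u s) + 16 * energy (2 * q) γ u₀ * s))
    (fun s hs => ((hu.hasDerivAt_vDotOne (hsub hs)).add ((hasDerivAt_id s).const_mul _)).neg)
    fun s _ => by
      have hnonlinear : 0 ≤ 8 * ((d * q - 4) * avgPotential q (u s) +
          2 * potential q (propagator 1 (u s))) / (2 * q + 2) := by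
        have : 0 ≤ (d * q - 4 : ℝ) := by linarith
        have havg := avgPotential_nonneg q (u s)
        have hend := potential_nonneg q (propagator 1 (u s))
        positivity
      linarith
  simp only [hu.initial] at hle
  linarith

lemma IsSolution.variance_le_focusing (hu : IsSolution (2 * q) γ u₀ I u) (hγ : 0 ≤ γ)
    (hdq : 4 ≤ (d * q : ℝ)) (ht : t ∈ I) (ht0 : t ≤ 0) :
    variance (u t) ≤
      variance u₀ + γ * vDotOne u₀ * t - 8 * γ * energy (2 * q) γ u₀ * t ^ 2 := by
  have hsub : Icc t 0 ⊆ I := hu.ordConnected.out ht hu.zero_mem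
  have hle := le_of_hasDerivAt_nonneg ht0
    (φ := fun s => variance (u s) -
      γ * (vDotOne u₀ * s - 8 * energy (2 * q) γ u₀ * s ^ 2))
    (fun s hs => (hu.hasDerivAt_variance (hsub hs)).sub
      ((((hasDerivAt_id s).const_mul _).sub ((hasDerivAt_pow 2 s).const_mul _)).const_mul γ))
    fun s hs => by
      have hlinear := mul_le_mul_of_nonneg_left (hu.vDotOne_ge hdq (hsub hs) hs.2) hγ
      have hnonlinear : 0 ≤ 8 * ((d * q - 2) *
          (∫ σ in (0 : ℝ)..1, σ * potential q (propagator σ (u s))) +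
          potential q (propagator 1 (u s))) / (2 * q + 2) := by
        have : 0 ≤ (d * q - 2 : ℝ) := by linarith
        have hmoment := integral_mul_potential_propagator_nonneg q (u s)
        have hend := potential_nonneg q (propagator 1 (u s))
        positivity
      rw [Nat.cast_ofNat, Nat.add_one_sub_one, pow_one]
      linarith
  simp only [hu.initial] at hle
  linarith

-- The corrector `-γ(s - t)v̇₁` cancels the indefinite term `γv̇₁` of `dv/ds`, and the energy term
-- then dominates the averaged potential. The condition `γt ≤ 1/2` keeps the coefficient of the
-- potential at `σ = 1` nonnegative.
lemma IsSolution.variance_le_defocusing (hu : IsSolution (2 * q) γ u₀ I u) (hγ : γ ≤ 0)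
    (hdq : 4 ≤ (d * q : ℝ)) (ht : t ∈ I) (htγ : γ * t ≤ 1 / 2) (ht0 : t ≤ 0) :
    variance (u t) ≤ variance u₀ + γ * vDotOne u₀ * t
      - 4 * γ * (d * q - 2) * energy (2 * q) γ u₀ * t ^ 2 := by
  have hsub : Icc t 0 ⊆ I := hu.ordConnected.out ht hu.zero_mem
  have hle := le_of_hasDerivAt_nonneg ht0
    (φ := fun s => variance (u s) + (-γ * (s - t)) * vDotOne (u s)
      + -4 * γ * (d * q - 2) * energy (2 * q) γ u₀ * (s - t) ^ 2)
    (fun s hs => ((hu.hasDerivAt_variance (hsub hs)).add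
      ((((hasDerivAt_id s).sub_const t).const_mul (-γ)).mul (hu.hasDerivAt_vDotOne (hsub hs)))).add
      ((((hasDerivAt_id s).sub_const t).pow 2).const_mul _))
    fun s hs => by
      have helapsed : 0 ≤ -γ * (s - t) := mul_nonneg (by linarith) (sub_nonneg.2 hs.1)
      have helapsed_le : -γ * (s - t) ≤ 1 / 2 := by
        linarith [mul_nonneg_of_nonpos_of_nonpos hγ hs.2]
      have hmoment : 0 ≤ (d * q - 2) *
          ((∫ σ in (0 : ℝ)..1, σ * potential q (propagator σ (u s))) / (2 * q + 2)) :=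
        mul_nonneg (by linarith)
          (div_nonneg (integral_mul_potential_propagator_nonneg q (u s)) (by positivity))
      have havg : 0 ≤ -γ * (s - t) * ((d * q - 4) *
          (energy (2 * q) γ u₀ - avgPotential q (u s) / (2 * q + 2))) :=
        mul_nonneg helapsed (mul_nonneg (by linarith) (sub_nonneg.2
          (hu.energy_eq_initial (hsub hs) ▸ avgPotential_div_le_energy hγ (u s))))
      have hend : 0 ≤ (1 / 2 - -γ * (s - t)) *
          (potential q (propagator 1 (u s)) / (2 * q + 2)) :=
        mul_nonneg (by linarith) (div_nonneg (potential_nonneg q _) (by positivity))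
      simp only [id_eq, Nat.cast_ofNat, Nat.add_one_sub_one, pow_one]
      linear_combination 8 * hmoment + 8 * havg + 16 * hend
  simp only [hu.initial] at hle
  linarith

end Bounds

end GabitovTuritsyn

end

open GabitovTuritsyn in
theorem mainTheorem5_general {d p : ℕ} (hp_even : Even p) (hdp : 8 ≤ (d * p : ℝ)) {γ : ℝ}
    {u₀ : 𝓢(Space d, ℂ)} {I : Set ℝ} {u : ℝ → 𝓢(Space d, ℂ)} (hu : IsSolution p γ u₀ I u)
    {t : ℝ} (ht : t ∈ I) :
    energy p γ (u t) = energy p γ u₀ ∧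
      (t ≤ 0 → vDotOne u₀ - 16 * energy p γ u₀ * t ≤ vDotOne (u t)) ∧
      (0 ≤ γ → t ≤ 0 →
        variance (u t) ≤ variance u₀ + γ * vDotOne u₀ * t - 8 * γ * energy p γ u₀ * t ^ 2) ∧
      (γ ≤ 0 → γ * t ≤ 1 / 2 → t ≤ 0 →
        variance (u t) ≤ variance u₀ + γ * vDotOne u₀ * t
          - 2 * γ * (d * p - 4) * energy p γ u₀ * t ^ 2) := by
  obtain ⟨q, rfl⟩ := even_iff_exists_two_mul.1 hp_even
  push_cast at hdp ⊢
  have hdq : 4 ≤ (d * q : ℝ) := by linarith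
  refine ⟨hu.energy_eq_initial ht, hu.vDotOne_ge hdq ht,
    fun hγ => hu.variance_le_focusing hγ hdq ht, fun hγ htγ ht0 => ?_⟩
  convert hu.variance_le_defocusing hγ hdq ht htγ ht0 using 2
  ring

open GabitovTuritsyn in
theorem mainTheorem5 (d p : ℕ) (hd : 1 ≤ d) (hp_even : Even p) (hp_two : 2 ≤ p)
    (hp : (8 : ℝ) / d ≤ p) :
    ∃ C : ℝ, 0 < C ∧
      ∀ (u₀ : 𝓢(Space d, ℂ)) (I : Set ℝ) (u : ℝ → 𝓢(Space d, ℂ)),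
        -- defocusing case
        (IsSolution p (-1) u₀ I u →
          ∀ t ∈ I, -(1 / 2 : ℝ) ≤ t → t ≤ 0 →
            variance (u t) ≤
              variance u₀ - vDotOne u₀ * t + C * energy p (-1) u₀ * t ^ 2) ∧
        -- focusing case
        (IsSolution p 1 u₀ I u →
          ∀ t ∈ I, t < 0 →
            variance (u t) ≤
              variance u₀ + vDotOne u₀ * t - 8 * energy p 1 u₀ * t ^ 2) ∧
        -- both cases; the energy is a constant of the motion
        (∀ γ : ℝ, γ = -1 ∨ γ = 1 → IsSolution p γ u₀ I u →
          (∀ t ∈ I, energy p γ (u t) = energy p γ u₀) ∧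
          ∀ t ∈ I, t < 0 → vDotOne u₀ - 16 * energy p γ u₀ * t ≤ vDotOne (u t)) := by
  have hdp : 8 ≤ (d * p : ℝ) := (div_le_iff₀' (by exact_mod_cast hd)).1 hp
  refine ⟨2 * (d * p - 4), by linarith, fun u₀ I u => ⟨fun hu t ht htl ht0 => ?_,
    fun hu t ht ht0 => ?_, fun γ _ hu => ⟨fun t ht => ?_, fun t ht ht0 => ?_⟩⟩⟩
  · linarith [(mainTheorem5_general hp_even hdp hu ht).2.2.2 (by norm_num) (by linarith) ht0]
  · linarith [(mainTheorem5_general hp_even hdp hu ht).2.2.1 zero_le_one ht0.le]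
  · exact (mainTheorem5_general hp_even hdp hu ht).1
  · exact (mainTheorem5_general hp_even hdp hu ht).2.1 ht0.le
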